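/- Let $(A,\mathfrak m)$ be a Noetherian local ring of Krull dimension $d$ whose associated graded ring $G_{\mathfrak m}(A)=\bigoplus_{n\ge 0}\mathfrak m^n/\mathfrak m^{n+1}$ is an integral domain. Let $e_0(A)=\lim_{n\to\infty} d!\,\ell_A(A/\mathfrak m^n)/n^d$ be the Hilbert–Samuel multiplicity of $A$, where $\ell_A$ denotes length; this limit exists. Let $s\ge 0$ be an integer and let $x\in\mathfrak m^s\setminus\mathfrak m^{s+1}$. Then the set of associated primes $P$ of the $A$-module $A/(x)$ whose height in $A$ is $1$ is finite, and $$\#\{P\in\operatorname{Ass}_A(A/(x)) : \operatorname{height} P=1\}\;\le\; s\,e_0(A).$$ -/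

import Mathlib

open IsLocalRing Filter

namespace AssocGraded

variable {A : Type*} [CommRing A] (I : Ideal A)

/-- The `n`-th graded piece `I ^ n / I ^ (n + 1)` of the associated graded ring. -/
abbrev Piece (n : ℕ) : Type _ :=
  ↥(I ^ n) ⧸ (I ^ (n + 1)).submoduleOf (I ^ n)

/-- The class in `I ^ n / I ^ (n + 1)` of an element of `I ^ n`. -/
def cls (n : ℕ) : ↥(I ^ n) →ₗ[A] Piece I n :=
  ((I ^ (n + 1)).submoduleOf (I ^ n)).mkQ

theorem cls_surjective (n : ℕ) : Function.Surjective (cls I n) :=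
  Submodule.mkQ_surjective _

theorem cls_eq_zero_iff {n : ℕ} (a : ↥(I ^ n)) : cls I n a = 0 ↔ (a : A) ∈ I ^ (n + 1) := by
  rw [cls, Submodule.mkQ_apply, Submodule.Quotient.mk_eq_zero]
  rfl

/-- The product `I ^ i × I ^ j → I ^ (i + j)`. -/
def powMul (i j : ℕ) : ↥(I ^ i) →ₗ[A] ↥(I ^ j) →ₗ[A] ↥(I ^ (i + j)) :=
  LinearMap.mk₂ A
    (fun a b => ⟨(a : A) * b, by rw [pow_add]; exact Ideal.mul_mem_mul a.2 b.2⟩)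
    (fun a a' b => Subtype.ext (by simp [add_mul]))
    (fun c a b => Subtype.ext (by simp [mul_assoc]))
    (fun a b b' => Subtype.ext (by simp [mul_add]))
    (fun c a b => Subtype.ext (by simp [mul_left_comm]))

@[simp]
theorem coe_powMul (i j : ℕ) (a : ↥(I ^ i)) (b : ↥(I ^ j)) :
    ((powMul I i j a b : ↥(I ^ (i + j))) : A) = (a : A) * b := rfl

/-- The product `I ^ i / I ^ (i + 1) × I ^ j / I ^ (j + 1) → I ^ (i + j) / I ^ (i + j + 1)`,
induced by the product of `A`. -/
def pieceMul (i j : ℕ) : Piece I i →ₗ[A] Piece I j →ₗ[A] Piece I (i + j) :=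
  Submodule.liftQ _
    (LinearMap.flip (Submodule.liftQ _ (LinearMap.flip ((powMul I i j).compr₂ (cls I (i + j))))
      (by
        intro b hb
        rw [LinearMap.mem_ker]
        ext a
        simp only [LinearMap.flip_apply, LinearMap.compr₂_apply, LinearMap.zero_apply]
        rw [cls_eq_zero_iff, coe_powMul, add_assoc, pow_add]
        exact Ideal.mul_mem_mul a.2 hb)))
    (by
      intro a ha
      rw [LinearMap.mem_ker]
      ext b
      simp only [LinearMap.comp_apply, Submodule.mkQ_apply, LinearMap.flip_apply,
        Submodule.liftQ_apply, LinearMap.compr₂_apply, LinearMap.zero_apply]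
      rw [cls_eq_zero_iff, coe_powMul, add_right_comm, pow_add]
      exact Ideal.mul_mem_mul ha b.2)

@[simp]
theorem pieceMul_cls (i j : ℕ) (a : ↥(I ^ i)) (b : ↥(I ^ j)) :
    pieceMul I i j (cls I i a) (cls I j b) = cls I (i + j) (powMul I i j a b) := rfl

/-- The class of `1` in `A / I`. -/
def pieceOne : Piece I 0 := cls I 0 ⟨1, by simp⟩

instance : GradedMonoid.GOne (Piece I) := ⟨pieceOne I⟩

instance : GradedMonoid.GMul (Piece I) := ⟨fun {i j} a b => pieceMul I i j a b⟩

theorem gmul_cls {i j : ℕ} (a : ↥(I ^ i)) (b : ↥(I ^ j)) :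
    (GradedMonoid.GMul.mul (cls I i a) (cls I j b) : Piece I (i + j)) =
      cls I (i + j) (powMul I i j a b) := rfl

theorem mk_cls_eq {i j : ℕ} (h : i = j) (a : ↥(I ^ i)) (b : ↥(I ^ j)) (hab : (a : A) = b) :
    (GradedMonoid.mk i (cls I i a) : GradedMonoid (Piece I)) =
      GradedMonoid.mk j (cls I j b) := by
  subst h
  rw [Subtype.ext hab]

theorem exists_cls (a : GradedMonoid (Piece I)) :
    ∃ (n : ℕ) (b : ↥(I ^ n)), a = GradedMonoid.mk n (cls I n b) := by
  obtain ⟨n, a⟩ := a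
  obtain ⟨b, rfl⟩ := cls_surjective I n a
  exact ⟨n, b, rfl⟩

instance : GradedMonoid.GCommMonoid (Piece I) where
  one_mul a := by
    obtain ⟨n, b, rfl⟩ := exists_cls I a
    exact mk_cls_eq I (zero_add n) _ _ (one_mul _)
  mul_one a := by
    obtain ⟨n, b, rfl⟩ := exists_cls I a
    exact mk_cls_eq I (add_zero n) _ _ (mul_one _)
  mul_assoc a b c := by
    obtain ⟨i, a, rfl⟩ := exists_cls I a
    obtain ⟨j, b, rfl⟩ := exists_cls I b
    obtain ⟨k, c, rfl⟩ := exists_cls I c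
    exact mk_cls_eq I (add_assoc i j k) _ _ (mul_assoc _ _ _)
  mul_comm a b := by
    obtain ⟨i, a, rfl⟩ := exists_cls I a
    obtain ⟨j, b, rfl⟩ := exists_cls I b
    exact mk_cls_eq I (add_comm i j) _ _ (mul_comm _ _)

instance : DirectSum.GCommRing (Piece I) where
  mul_zero a := map_zero (pieceMul I _ _ a)
  zero_mul b := by
    change pieceMul I _ _ 0 b = 0
    rw [map_zero, LinearMap.zero_apply]
  mul_add a b c := map_add (pieceMul I _ _ a) b c
  add_mul a b c := by
    change pieceMul I _ _ (a + b) c = pieceMul I _ _ a c + pieceMul I _ _ b c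
    rw [map_add, LinearMap.add_apply]
  mul_comm := GradedMonoid.GCommMonoid.mul_comm
  natCast n := (n : A) • pieceOne I
  natCast_zero := by rw [Nat.cast_zero, zero_smul]
  natCast_succ n := by
    rw [Nat.cast_succ, add_smul, one_smul]
    rfl
  intCast n := (n : A) • pieceOne I
  intCast_ofNat n := by rw [Int.cast_natCast]
  intCast_negSucc_ofNat n := by
    rw [Int.cast_negSucc, neg_smul]

end AssocGraded

/-- The associated graded ring `⨁ n, I ^ n / I ^ (n + 1)` of the ideal `I`, with its
multiplication induced by that of `A`. -/
abbrev AssociatedGradedRing {A : Type*} [CommRing A] (I : Ideal A) : Type _ :=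
  DirectSum ℕ (AssocGraded.Piece I)

/-- The set of associated primes of the `A`-module `M` that have height `i` (in `A`). -/
def associatedPrimesOfHeight (A M : Type*) [CommRing A] [AddCommGroup M] [Module A M] (i : ℕ) :
    Set (Ideal A) :=
  {P | P ∈ associatedPrimes A M ∧ P.height = i}

/-- The Krull dimension of `A` as a natural number; it is the true dimension when that is finite,
for example if `A` is a Noetherian local ring. -/
noncomputable def natKrullDim (A : Type*) [CommRing A] : ℕ :=
  ((ringKrullDim A).unbotD 0).toNat

/-- The Hilbert-Samuel function `n ↦ length (A / 𝔪 ^ n)` of a local ring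
(the length is finite if `A` is Noetherian). -/
noncomputable def hilbertSamuelFunction (A : Type*) [CommRing A] [IsLocalRing A] (n : ℕ) : ℕ :=
  (Module.length A (A ⧸ maximalIdeal A ^ n)).toNat

/-- The sequence `d! * length (A / 𝔪 ^ n) / n ^ d`, where `d = dim A`. -/
noncomputable def normalizedHilbertSamuel (A : Type*) [CommRing A] [IsLocalRing A] (n : ℕ) : ℝ :=
  ((natKrullDim A).factorial : ℝ) * (hilbertSamuelFunction A n : ℝ) / (n : ℝ) ^ natKrullDim A

/-- The Hilbert-Samuel multiplicity `e₀(A) = lim d! * length (A / 𝔪 ^ n) / n ^ d` of a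
local ring. -/
noncomputable def hilbertSamuelMultiplicity (A : Type*) [CommRing A] [IsLocalRing A] : ℝ :=
  limUnder atTop (normalizedHilbertSamuel A)

/-! Put H(n) = ℓ(A/𝔪^n), G = G_𝔪(A), and let ξ be the initial form of x. Since G is a domain, orders
add under multiplication. Hence A is a domain and x * a ∈ 𝔪^(s+n) forces a ∈ 𝔪^n, so that ℓ(A/((x) +
𝔪^(n+s))) ≤ H(n+s) - H(n), whose leading term is s e₀ n^(d-1)/(d-1)!. A height-one prime containing
x ≠ 0 is minimal over (x), and for finitely many such P the sum of the ℓ(A/(P + 𝔪^n)) is at most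
ℓ(A/((x) + 𝔪^(n+c))) for a constant c (`exists_sum_samuelLength_le`). If every A/P has Samuel
function of degree d - 1, its normalized leading coefficient is a positive integer, and comparing
leading terms bounds the number of P by s e₀ (`AssocGraded.sum_multiplicity_le`).

The hard point is that dim A/P = d - 1, as A is not assumed catenary
(`AssocGraded.growth_degree_eq`). The argument takes place in G. Let Q be the initial ideal of P,
and let S ⊆ G be a polynomial ring over the residue field with G finite over S. If Q ∩ S lies in a
proper principal ideal (p), then G/Q is large enough to bound the growth of ℓ(A/(P + 𝔪^n)) from
below (`exists_relLength_le_mul_relLength`).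

Otherwise Q ∩ S has no common factor. Choose y ∉ P and k with y P^k ⊆ (x), and let K_n be the
initial ideal of (x^n) : P^(kn). Powers of elements of Q carry K_n into (ξ^n). A free module over a
factorial ring is determined at the primes, so the fractions K_n/ξ^n, multiplied by one common
denominator, lie in a finite free S-module. They form an increasing chain, hence K_(n+1) ⊆ ξ K_n for
some n (`exists_eq_mul_of_pow_mul_mem_span`). But y^(n+1) lies in (x^(n+1)) : P^(k(n+1)). Lifting
the divisibility by ξ order by order puts y^(n+1) into P + 𝔪^i for all i, so y ∈ P, a contradiction
(`AssocGraded.exists_mem_initialIdeal_colon_not_mul`).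

The limit e₀ exists because iterated differences of H eventually vanish. The degree of H is the
Krull dimension by the usual comparison with chains of primes and with systems of parameters. -/

/-! ### Relative lengths of submodules -/

section RelLength

variable {A : Type*} [CommRing A] {M N : Type*} [AddCommGroup M] [Module A M]
  [AddCommGroup N] [Module A N]

/-- The length of `X / (X ∩ Y)` for submodules `X`, `Y` of a module. -/
noncomputable def relLength (Y X : Submodule A M) : ℕ∞ :=
  Module.length A (↥X ⧸ Y.submoduleOf X)

theorem relLength_le_of_map_le {X Y : Submodule A M} {X' Y' : Submodule A N} (φ : M →ₗ[A] N)
    (hX : X.map φ ≤ X') (hY : ∀ a ∈ X, φ a ∈ Y' → a ∈ Y) : relLength Y X ≤ relLength Y' X' := by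
  let ψ : X →ₗ[A] X' := φ.restrict (fun a ha => hX (Submodule.mem_map_of_mem ha))
  let χ : X →ₗ[A] X' ⧸ Y'.submoduleOf X' := (Y'.submoduleOf X').mkQ.comp ψ
  have h1 : LinearMap.ker χ ≤ Y.submoduleOf X := by
    intro a ha
    have h2 : ψ a ∈ Y'.submoduleOf X' := by
      rw [← Submodule.ker_mkQ (Y'.submoduleOf X')]
      exact ha
    exact hY a a.2 h2
  calc relLength Y X ≤ Module.length A (↥X ⧸ LinearMap.ker χ) :=
        Module.length_le_of_surjective (Submodule.factor h1) (Submodule.factor_surjective h1)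
    _ ≤ relLength Y' X' :=
        Module.length_le_of_injective ((LinearMap.ker χ).liftQ χ le_rfl)
          (LinearMap.ker_eq_bot.mp (Submodule.ker_liftQ_eq_bot _ _ _ le_rfl))

/-- In N / Y' the image of X' lies in the image of X, and the latter is a quotient of X / (X ∩ Y).
-/
theorem relLength_le_of_le_map {X Y : Submodule A M} {X' Y' : Submodule A N} (φ : M →ₗ[A] N)
    (hX : X' ≤ X.map φ ⊔ Y') (hY : ∀ a ∈ X, a ∈ Y → φ a ∈ Y') :
    relLength Y' X' ≤ relLength Y X := by
  let χ : X →ₗ[A] N ⧸ Y' := Y'.mkQ.comp (φ.comp X.subtype)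
  let θ : X' →ₗ[A] N ⧸ Y' := Y'.mkQ.comp X'.subtype
  have hθ : LinearMap.ker θ = Y'.submoduleOf X' := by
    rw [LinearMap.ker_comp, Submodule.ker_mkQ]
    rfl
  have hχ : Y.submoduleOf X ≤ LinearMap.ker χ := by
    intro a ha
    have : φ a ∈ Y' := hY a a.2 ha
    simpa [χ] using this
  have hr : LinearMap.range θ ≤ LinearMap.range χ := by
    rintro _ ⟨a, rfl⟩
    obtain ⟨b, hb, c, hc, hbc⟩ := Submodule.mem_sup.mp (hX a.2)
    obtain ⟨b, hb, rfl⟩ := hb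
    refine ⟨⟨b, hb⟩, ?_⟩
    simp only [χ, θ, LinearMap.comp_apply, Submodule.subtype_apply, ← hbc, map_add]
    rw [(Submodule.Quotient.mk_eq_zero Y').mpr hc |> (show Y'.mkQ c = 0 from ·), add_zero]
  have e1 : relLength Y' X' = Module.length A (LinearMap.range θ) := by
    rw [relLength, ← hθ]
    exact (θ.quotKerEquivRange).length_eq
  rw [e1]
  calc Module.length A (LinearMap.range θ) ≤ Module.length A (LinearMap.range χ) :=
        Module.length_le_of_injective (Submodule.inclusion hr) (Submodule.inclusion_injective hr)
    _ = Module.length A (↥X ⧸ LinearMap.ker χ) := (χ.quotKerEquivRange).length_eq.symm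
    _ ≤ relLength Y X :=
        Module.length_le_of_surjective (Submodule.factor hχ) (Submodule.factor_surjective hχ)

theorem relLength_eq_of_map {X Y : Submodule A M} {X' Y' : Submodule A N} (φ : M →ₗ[A] N)
    (h1 : X.map φ ≤ X') (h2 : X' ≤ X.map φ ⊔ Y') (h3 : ∀ a ∈ X, φ a ∈ Y' ↔ a ∈ Y) :
    relLength Y X = relLength Y' X' :=
  le_antisymm (relLength_le_of_map_le φ h1 fun a ha => (h3 a ha).mp)
    (relLength_le_of_le_map φ h2 fun a ha => (h3 a ha).mpr)

theorem relLength_mono {X Y X' Y' : Submodule A M} (hX : X ≤ X') (hY : Y' ≤ Y) :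
    relLength Y X ≤ relLength Y' X' :=
  relLength_le_of_map_le LinearMap.id (by simpa using hX) fun _ _ h => hY h

theorem relLength_sup (Y X : Submodule A M) : relLength Y (Y ⊔ X) = relLength Y X :=
  (relLength_eq_of_map LinearMap.id (by simp) (by simp [sup_comm]) fun _ _ => Iff.rfl).symm

theorem relLength_self (Y : Submodule A M) : relLength Y Y = 0 := by
  rw [relLength, Module.length_eq_zero_iff, Submodule.Quotient.subsingleton_iff,
    Submodule.submoduleOf_self]

theorem relLength_top (Y : Submodule A M) : relLength Y ⊤ = Module.length A (M ⧸ Y) := by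
  have : relLength Y ⊤ = relLength (⊥ : Submodule A (M ⧸ Y)) ⊤ := by
    refine relLength_eq_of_map Y.mkQ le_top ?_ (by simp)
    rw [Submodule.map_top, Submodule.range_mkQ]
    exact le_sup_left
  rw [this, relLength]
  have e : Submodule.submoduleOf (⊥ : Submodule A (M ⧸ Y)) ⊤ = ⊥ := by
    ext a
    simp [Submodule.submoduleOf]
  rw [e, (Submodule.quotEquivOfEqBot (⊥ : Submodule A (⊤ : Submodule A (M ⧸ Y))) rfl).length_eq,
    Module.length_top]

theorem relLength_bot (X : Submodule A M) : relLength ⊥ X = Module.length A X := by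
  have e : Submodule.submoduleOf (⊥ : Submodule A M) X = ⊥ := by
    ext a
    simp [Submodule.submoduleOf]
  rw [relLength, e, (Submodule.quotEquivOfEqBot (⊥ : Submodule A X) rfl).length_eq]

theorem relLength_add {Y Z X : Submodule A M} (hYZ : Y ≤ Z) (hZX : Z ≤ X) :
    relLength Y Z + relLength Z X = relLength Y X := by
  have h1 : Y.submoduleOf X ≤ Z.submoduleOf X := fun a ha => hYZ ha
  have h0 : Y.submoduleOf Z ≤ (Y.submoduleOf X).comap (Submodule.inclusion hZX) :=
    fun a ha => ha
  refine (Module.length_eq_add_of_exact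
    (Submodule.mapQ _ _ (Submodule.inclusion hZX) h0) (Submodule.factor h1)
    ?_ (Submodule.factor_surjective h1) ?_).symm
  · rw [← LinearMap.ker_eq_bot, Submodule.ker_mapQ, eq_bot_iff, Submodule.map_le_iff_le_comap]
    intro a ha
    rw [Submodule.comap_bot, Submodule.ker_mkQ]
    exact ha
  · intro a
    obtain ⟨a, rfl⟩ := Submodule.mkQ_surjective _ a
    constructor
    · intro h
      have h2 : (a : M) ∈ Z := by
        have : (Z.submoduleOf X).mkQ a = 0 := h
        rw [Submodule.mkQ_apply, Submodule.Quotient.mk_eq_zero] at this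
        exact this
      exact ⟨(Y.submoduleOf Z).mkQ ⟨a, h2⟩, rfl⟩
    · rintro ⟨b, hb⟩
      obtain ⟨b, rfl⟩ := Submodule.mkQ_surjective _ b
      rw [← hb]
      change (Z.submoduleOf X).mkQ (Submodule.inclusion hZX b) = 0
      rw [Submodule.mkQ_apply, Submodule.Quotient.mk_eq_zero]
      exact b.2

end RelLength

/-! ### Hilbert functions by iterated differences -/

theorem fwdDiff_iter_sub {f g : ℕ → ℤ} (r : ℕ) :
    (fwdDiff 1)^[r] (f - g) = (fwdDiff 1)^[r] f - (fwdDiff 1)^[r] g := by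
  have h := fwdDiff_iter_add (1 : ℕ) (f - g) g r
  rw [sub_add_cancel] at h
  rw [h, add_sub_cancel_right]

theorem fwdDiff_iter_congr {f g : ℕ → ℤ} {n₀ : ℕ} (h : ∀ n ≥ n₀, f n = g n) (r : ℕ) :
    ∀ n ≥ n₀, (fwdDiff 1)^[r] f n = (fwdDiff 1)^[r] g n := by
  intro n hn
  rw [fwdDiff_iter_eq_sum_shift, fwdDiff_iter_eq_sum_shift]
  refine Finset.sum_congr rfl fun k _ => ?_
  rw [h _ (le_add_right hn)]

section Hilbert

variable {A : Type*} [CommRing A]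

/-- The ascending chain condition for families of ideals between `Y` and `X` that are stable under
multiplication by `z i` from degree `n` to degree `n + 1`. -/
def StableACC {r : ℕ} (z : Fin r → A) (X Y : ℕ → Ideal A) : Prop :=
  ∀ N : ℕ → ℕ → Ideal A, (∀ j n, Y n ≤ N j n) → (∀ j n, N j n ≤ X n) →
    (∀ j i n, ∀ a ∈ N j n, z i * a ∈ N j (n + 1)) → (∀ j n, N j n ≤ N (j + 1) n) →
    ∃ J, ∀ j ≥ J, ∀ n, N j n = N J n

/-- **Hilbert's theorem** on the length function of a graded module. -/
theorem exists_fwdDiff_iter_relLength_eq_zero (r : ℕ) (z : Fin r → A) (X Y : ℕ → Ideal A)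
    (hYX : ∀ n, Y n ≤ X n) (hfin : ∀ n, relLength (Y n) (X n) ≠ ⊤)
    (hX : ∀ i n, ∀ a ∈ X n, z i * a ∈ X (n + 1)) (hY : ∀ i n, ∀ a ∈ Y n, z i * a ∈ Y (n + 1))
    (hacc : StableACC z X Y) :
    ∃ n₀, ∀ n ≥ n₀, (fwdDiff 1)^[r] (fun n => ((relLength (Y n) (X n)).toNat : ℤ)) n = 0 := by
  induction r generalizing X Y with
  | zero =>
    -- With no operators every family is stable. The chain that fills in X one degree at a time can
    -- only stop if X = Y in all large degrees.
    obtain ⟨J, hJ⟩ := hacc (fun j n => if n < j then X n else Y n)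
      (fun j n => by split_ifs <;> simp [hYX]) (fun j n => by split_ifs <;> simp [hYX])
      (fun j i => i.elim0)
      (fun j n => by split_ifs <;> first | exact le_rfl | exact hYX n | omega)
    refine ⟨J, fun n hn => ?_⟩
    have h := hJ (n + 1) (by omega) n
    rw [if_pos (by omega), if_neg (by omega)] at h
    simp [h, relLength_self]
  | succ r ih =>
    let w := z (Fin.last r)
    let φ : A →ₗ[A] A := LinearMap.mulLeft A w
    let z' : Fin r → A := fun i => z i.castSucc
    -- K n / Y n and X (n + 1) / C n are the kernel and cokernel of multiplication by the last
    -- generator. It kills both, so the remaining r generators suffice for the induction.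
    let K : ℕ → Ideal A := fun n => X n ⊓ Submodule.comap φ (Y (n + 1))
    let C : ℕ → Ideal A := fun n => Y (n + 1) ⊔ Submodule.map φ (X n)
    have hYK : ∀ n, Y n ≤ K n := fun n => le_inf (hYX n) fun a ha => hY _ n a ha
    have hYC : ∀ n, Y (n + 1) ≤ C n := fun n => le_sup_left
    have hXφ : ∀ n, Submodule.map φ (X n) ≤ X (n + 1) := fun n => by
      rintro _ ⟨a, ha, rfl⟩
      exact hX _ n a ha
    have hCX : ∀ n, C n ≤ X (n + 1) := fun n => sup_le (hYX _) (hXφ n)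
    have hiso : ∀ n, relLength (K n) (X n) = relLength (Y (n + 1)) (C n) := fun n => by
      refine relLength_eq_of_map φ le_sup_right (le_of_eq (sup_comm _ _)) fun a ha => ?_
      exact ⟨fun h => ⟨ha, h⟩, fun h => h.2⟩
    have e1 : ∀ n, relLength (Y n) (K n) + relLength (K n) (X n) = relLength (Y n) (X n) :=
      fun n => relLength_add (hYK n) inf_le_left
    have e2 : ∀ n, relLength (Y (n + 1)) (C n) + relLength (C n) (X (n + 1)) =
        relLength (Y (n + 1)) (X (n + 1)) := fun n => relLength_add (hYC n) (hCX n)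
    have f1 : ∀ n, relLength (Y n) (K n) ≠ ⊤ ∧ relLength (K n) (X n) ≠ ⊤ := fun n => by
      have := hfin n
      rw [← e1 n] at this
      simpa [not_or] using this
    have f2 : ∀ n, relLength (C n) (X (n + 1)) ≠ ⊤ := fun n => by
      have := hfin (n + 1)
      rw [← e2 n] at this
      exact (by simpa [not_or] using this : _ ∧ _).2
    obtain ⟨n₁, h1⟩ := ih z' K Y hYK (fun n => (f1 n).1)
      (by
        intro i n a ha
        refine ⟨hX _ n a ha.1, ?_⟩
        change w * (z' i * a) ∈ Y (n + 1 + 1)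
        rw [mul_left_comm]
        exact hY _ _ _ ha.2)
      (fun i n => hY _ n)
      (by
        intro N hN1 hN2 hN3 hN4
        refine hacc N hN1 (fun j n => (hN2 j n).trans inf_le_left) ?_ hN4
        intro j i
        refine Fin.lastCases ?_ (fun i => ?_) i
        · intro n a ha
          exact hN1 _ _ (hN2 j n ha).2
        · exact hN3 j i)
    obtain ⟨n₂, h2⟩ := ih z' (fun n => X (n + 1)) C hCX f2 (fun i n => hX _ _)
      (by
        intro i n a ha
        obtain ⟨b, hb, c, hc, rfl⟩ := Submodule.mem_sup.mp ha
        obtain ⟨c, hc, rfl⟩ := hc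
        rw [mul_add]
        refine Submodule.add_mem_sup (hY _ _ _ hb) ⟨z' i * c, hX _ _ _ hc, ?_⟩
        simp only [φ, LinearMap.mulLeft_apply]
        ring)
      (by
        intro N hN1 hN2 hN3 hN4
        -- The cokernel starts in degree 1 of the original module, so the family is shifted by one
        -- and completed by Y 0 in degree 0.
        obtain ⟨J, hJ⟩ := hacc (fun j n => if n = 0 then Y 0 else N j (n - 1))
          (by
            intro j n
            rcases n with _ | n
            · simp
            · simpa using (hYC n).trans (hN1 j n))
          (by
            intro j n
            rcases n with _ | n
            · simpa using hYX 0
            · simpa using hN2 j n)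
          (by
            intro j i n a ha
            rcases n with _ | n
            · simp only [if_true] at ha
              simpa using hN1 j 0 (hYC 0 (hY _ _ _ ha))
            · simp only [Nat.add_eq_zero_iff, one_ne_zero, and_false, if_false,
                Nat.add_sub_cancel] at ha ⊢
              revert ha
              refine Fin.lastCases (fun ha => ?_) (fun i ha => hN3 j i n a ha) i
              exact hN1 j _ (Submodule.mem_sup_right ⟨a, hN2 j n ha, rfl⟩))
          (by
            intro j n
            rcases n with _ | n
            · simp
            · simpa using hN4 j n)
        exact ⟨J, fun j hj n => by simpa using hJ j hj (n + 1)⟩)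
    refine ⟨max n₁ n₂, fun n hn => ?_⟩
    have key : fwdDiff 1 (fun n => ((relLength (Y n) (X n)).toNat : ℤ)) =
        (fun n => ((relLength (C n) (X (n + 1))).toNat : ℤ)) -
          fun n => ((relLength (Y n) (K n)).toNat : ℤ) := by
      funext n
      have a1 : (relLength (Y n) (X n)).toNat =
          (relLength (Y n) (K n)).toNat + (relLength (K n) (X n)).toNat := by
        rw [← e1 n, ENat.toNat_add (f1 n).1 (f1 n).2]
      have a2 : (relLength (Y (n + 1)) (X (n + 1))).toNat =
          (relLength (K n) (X n)).toNat + (relLength (C n) (X (n + 1))).toNat := by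
        rw [← e2 n, ← hiso n, ENat.toNat_add (f1 n).2 (f2 n)]
      simp only [fwdDiff, Pi.sub_apply, a1, a2]
      push_cast
      ring
    rw [Function.iterate_succ_apply, key, fwdDiff_iter_sub, Pi.sub_apply, h1 n (by omega),
      h2 n (by omega), sub_zero]

end Hilbert

/-! ### Samuel functions and the Rees algebra -/

section HilbertSamuel

variable {A : Type*} [CommRing A]

open Polynomial in
/-- The ideal of the Rees algebra of `q` given by a `q`-stable family of ideals. -/
def reesIdeal (q : Ideal A) (N : ℕ → Ideal A) (hN : ∀ n, q * N n ≤ N (n + 1)) :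
    Ideal (reesAlgebra q) where
  carrier := {f | ∀ n, (f : A[X]).coeff n ∈ N n}
  add_mem' := fun {f g} hf hg n => by
    simpa using add_mem (hf n) (hg n)
  zero_mem' := fun n => by simp
  smul_mem' := fun f g hg n => by
    have h : ∀ i j, q ^ i * N j ≤ N (i + j) := by
      intro i
      induction i with
      | zero => intro j; simp
      | succ i ih =>
        intro j
        rw [pow_succ', mul_assoc, add_right_comm]
        exact (Ideal.mul_mono_right (ih j)).trans (hN _)
    simp only [smul_eq_mul, MulMemClass.coe_mul, coeff_mul]
    refine sum_mem fun ij hij => ?_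
    rw [← Finset.HasAntidiagonal.mem_antidiagonal.mp hij]
    exact h _ _ (Ideal.mul_mem_mul (f.2 ij.1) (hg ij.2))

/-- A stable family gives an ideal of the Rees algebra, which is Noetherian. Since I ⊆ N n ⊆ I +
q^n, the family is determined by the intersections N n ∩ q^n, and so by that ideal. -/
theorem stableACC_pow [IsNoetherianRing A] (I q : Ideal A) {r : ℕ} (z : Fin r → A)
    (hz : Ideal.span (Set.range z) = q) :
    StableACC z (fun n => I ⊔ q ^ n) (fun n => I ⊔ q ^ (n + 1)) := by
  intro N h1 h2 h3 h4
  have hq : ∀ j n, q * N j n ≤ N j (n + 1) := by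
    intro j n
    rw [← hz]
    refine Ideal.mul_le.mpr fun a ha b hb => ?_
    induction ha using Submodule.span_induction with
    | mem a ha =>
      obtain ⟨i, rfl⟩ := ha
      exact h3 j i n b hb
    | zero => simp
    | add a a' _ _ h h' => rw [add_mul]; exact add_mem h h'
    | smul c a _ h => rw [smul_eq_mul, mul_assoc]; exact Ideal.mul_mem_left _ _ h
  obtain ⟨J, hJ⟩ := monotone_stabilizes_iff_noetherian.mpr
    (inferInstanceAs (IsNoetherianRing (reesAlgebra q)))
    ⟨fun j => reesIdeal q (N j) (hq j),
      monotone_nat_of_le_succ fun j f hf n => h4 j n (hf n)⟩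
  have hm : ∀ j n, ∀ a ∈ N j n, a ∈ q ^ n → ∀ j', reesIdeal q (N j) (hq j) =
      reesIdeal q (N j') (hq j') → a ∈ N j' n := by
    intro j n a ha ha' j' e
    have h5 : (⟨Polynomial.monomial n a, reesAlgebra.monomial_mem.mpr ha'⟩ : reesAlgebra q) ∈
        reesIdeal q (N j) (hq j) := by
      intro k
      rw [Polynomial.coeff_monomial]
      split_ifs with h
      · exact h ▸ ha
      · exact zero_mem _
    rw [e] at h5
    simpa using h5 n
  have hle : ∀ j j' n, reesIdeal q (N j) (hq j) = reesIdeal q (N j') (hq j') →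
      N j n ≤ N j' n := by
    intro j j' n e a ha
    obtain ⟨b, hb, c, hc, rfl⟩ := Submodule.mem_sup.mp (h2 j n ha)
    have hb' : ∀ j, b ∈ N j n := fun j => h1 j n (Submodule.mem_sup_left hb)
    exact add_mem (hb' _) (hm j n c (by simpa using sub_mem ha (hb' j)) hc j' e)
  exact ⟨J, fun j hj n => le_antisymm (hle _ _ _ (hJ j hj).symm) (hle _ _ _ (hJ j hj))⟩

theorem length_quotient_ne_top [IsLocalRing A] [IsNoetherianRing A] {J : Ideal A} {c : ℕ}
    (hJ : maximalIdeal A ^ c ≤ J) : Module.length A (A ⧸ J) ≠ ⊤ := by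
  by_cases hJ' : J = ⊤
  · have := Ideal.Quotient.subsingleton_iff.mpr hJ'
    simp
  have : Nontrivial (A ⧸ J) := Ideal.Quotient.nontrivial_iff.mpr hJ'
  have : IsLocalRing (A ⧸ J) :=
    IsLocalRing.of_surjective' (Ideal.Quotient.mk J) Ideal.Quotient.mk_surjective
  have : IsArtinianRing (A ⧸ J) := by
    rw [isArtinianRing_iff_isNilpotent_maximalIdeal]
    refine ⟨c, ?_⟩
    rw [← map_maximalIdeal_of_surjective _ (Ideal.Quotient.mk_surjective (I := J)),
      ← Ideal.map_pow, Ideal.zero_eq_bot, Ideal.map_eq_bot_iff_le_ker, Ideal.mk_ker]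
    exact hJ
  have : IsArtinian A (A ⧸ J) :=
    isArtinian_of_surjective_algebraMap (S := A) (R := A ⧸ J) (M := A ⧸ J)
      Ideal.Quotient.mk_surjective
  exact Module.length_ne_top

/-- The length of `A / (I + q ^ n)`. -/
noncomputable def samuelLength (I q : Ideal A) (n : ℕ) : ℕ :=
  (Module.length A (A ⧸ (I ⊔ q ^ n))).toNat

/-- The first difference of the Samuel function is the Hilbert function of the quotients (I + q^n) /
(I + q^(n+1)), which accounts for the exponent r + 1. -/
theorem exists_fwdDiff_iter_samuelLength_eq_zero [IsLocalRing A] [IsNoetherianRing A]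
    (I q : Ideal A) {c : ℕ} (hq : maximalIdeal A ^ c ≤ q) {r : ℕ} (z : Fin r → A)
    (hz : Ideal.span (Set.range z) = q) :
    ∃ n₀, ∀ n ≥ n₀, (fwdDiff 1)^[r + 1] (fun n => (samuelLength I q n : ℤ)) n = 0 := by
  have hfin : ∀ n, relLength (I ⊔ q ^ n) ⊤ ≠ ⊤ := fun n => by
    rw [relLength_top]
    refine length_quotient_ne_top (c := c * n) ?_
    rw [pow_mul]
    exact (Ideal.pow_right_mono hq n).trans le_sup_right
  have hle : ∀ n, I ⊔ q ^ (n + 1) ≤ I ⊔ q ^ n := fun n =>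
    sup_le_sup_left (Ideal.pow_le_pow_right n.le_succ) _
  have hadd : ∀ n, relLength (I ⊔ q ^ (n + 1)) (I ⊔ q ^ n) + relLength (I ⊔ q ^ n) ⊤ =
      relLength (I ⊔ q ^ (n + 1)) ⊤ := fun n => relLength_add (hle n) le_top
  have hfin' : ∀ n, relLength (I ⊔ q ^ (n + 1)) (I ⊔ q ^ n) ≠ ⊤ := fun n h => by
    apply hfin (n + 1)
    rw [← hadd n, h, top_add]
  have hzq : ∀ i, z i ∈ q := fun i => hz ▸ Ideal.subset_span ⟨i, rfl⟩
  have hmul : ∀ i n, ∀ a ∈ I ⊔ q ^ n, z i * a ∈ I ⊔ q ^ (n + 1) := by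
    intro i n a ha
    obtain ⟨b, hb, c, hc, rfl⟩ := Submodule.mem_sup.mp ha
    rw [mul_add, pow_succ']
    exact Submodule.add_mem_sup (I.mul_mem_left _ hb) (Ideal.mul_mem_mul (hzq i) hc)
  obtain ⟨n₀, h⟩ := exists_fwdDiff_iter_relLength_eq_zero r z (fun n => I ⊔ q ^ n)
    (fun n => I ⊔ q ^ (n + 1)) hle hfin' hmul (fun i n => hmul i (n + 1)) (stableACC_pow I q z hz)
  refine ⟨n₀, fun n hn => ?_⟩
  rw [Function.iterate_succ_apply, ← h n hn]
  refine congrFun (congrArg ((fwdDiff 1)^[r]) (funext fun n => ?_)) n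
  simp only [fwdDiff, samuelLength, ← relLength_top]
  rw [← hadd n, ENat.toNat_add (hfin' n) (hfin n)]
  push_cast
  ring

end HilbertSamuel

/-! ### Polynomial growth -/

section Growth

open Topology

theorem Filter.Tendsto.congr_lim {u : ℕ → ℝ} {a b : ℝ} (h : Tendsto u atTop (𝓝 a)) (e : a = b) :
    Tendsto u atTop (𝓝 b) := e ▸ h

theorem tendsto_add_div_self (b : ℕ) :
    Tendsto (fun n : ℕ => ((n + b : ℕ) : ℝ) / n) atTop (𝓝 1) := by
  have h : Tendsto (fun n : ℕ => 1 + (b : ℝ) / n) atTop (𝓝 (1 + 0)) :=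
    tendsto_const_nhds.add (tendsto_const_div_atTop_nhds_zero_nat (b : ℝ))
  rw [add_zero] at h
  refine h.congr' ?_
  filter_upwards [eventually_gt_atTop 0] with n hn
  have : (n : ℝ) ≠ 0 := by positivity
  push_cast
  field_simp

theorem tendsto_div_pow_of_shift {u : ℕ → ℝ} {b D : ℕ} {l : ℝ}
    (h : Tendsto (fun n : ℕ => u (n + b) / (n : ℝ) ^ D) atTop (𝓝 l)) :
    Tendsto (fun n : ℕ => u n / (n : ℝ) ^ D) atTop (𝓝 l) := by
  rw [← tendsto_add_atTop_iff_nat b]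
  have h1 := h.div ((tendsto_add_div_self b).pow D) (by simp)
  rw [one_pow, div_one] at h1
  refine h1.congr' ?_
  filter_upwards [eventually_gt_atTop 0] with n hn
  have : (n : ℝ) ≠ 0 := by positivity
  have : ((n + b : ℕ) : ℝ) ≠ 0 := by positivity
  simp only [Pi.div_apply, div_pow]
  field_simp

theorem tendsto_shift_div_pow {u : ℕ → ℝ} {D : ℕ} {l : ℝ} (b : ℕ)
    (h : Tendsto (fun n : ℕ => u n / (n : ℝ) ^ D) atTop (𝓝 l)) :
    Tendsto (fun n : ℕ => u (n + b) / (n : ℝ) ^ D) atTop (𝓝 l) := by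
  have h1 := ((tendsto_add_atTop_iff_nat b).mpr h).mul ((tendsto_add_div_self b).pow D)
  rw [one_pow, mul_one] at h1
  refine h1.congr' ?_
  filter_upwards [eventually_gt_atTop 0] with n hn
  have : (n : ℝ) ≠ 0 := by positivity
  have : ((n + b : ℕ) : ℝ) ≠ 0 := by positivity
  rw [div_pow]
  field_simp

theorem tendsto_choose_div_pow {k D : ℕ} (h : k ≤ D) :
    Tendsto (fun n : ℕ => (n.choose k : ℝ) / (n : ℝ) ^ D) atTop
      (𝓝 (if k = D then 1 / (D.factorial : ℝ) else 0)) := by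
  have h1 : Tendsto (fun n : ℕ => (n.choose k : ℝ) / (n : ℝ) ^ k) atTop
      (𝓝 (1 / (k.factorial : ℝ))) := by
    have h3 := (Asymptotics.isEquivalent_iff_tendsto_one ?_).mp (isEquivalent_choose k)
    · refine (h3.mul_const (1 / (k.factorial : ℝ))).congr_lim (one_mul _) |>.congr fun n => ?_
      simp only [Pi.div_apply]
      field_simp
    · filter_upwards [eventually_gt_atTop 0] with n hn
      positivity
  split_ifs with hk
  · rwa [← hk]
  · have h3 : Tendsto (fun n : ℕ => ((n : ℝ) ^ (D - k))⁻¹) atTop (𝓝 0) :=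
      tendsto_inv_atTop_zero.comp
        ((tendsto_pow_atTop (by omega)).comp tendsto_natCast_atTop_atTop)
    have h4 := h1.mul h3
    rw [mul_zero] at h4
    refine h4.congr fun n => ?_
    rw [div_mul_eq_mul_div, ← div_eq_mul_inv, div_div, ← pow_add, Nat.sub_add_cancel h]

/-- `f` grows like `c * n ^ D / D !`, and its difference function accordingly. -/
structure HasGrowth (f : ℕ → ℕ) (D c : ℕ) : Prop where
  pos : 0 < c
  tendsto : Tendsto (fun n : ℕ => (f n : ℝ) / (n : ℝ) ^ D) atTop (𝓝 (c / D.factorial))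
  tendsto_diff : Tendsto (fun n : ℕ => ((f (n + 1) : ℝ) - f n) * n / (n : ℝ) ^ D) atTop
    (𝓝 (D * c / D.factorial))

/-- Newton's formula at n₀ writes f as an integral combination of binomial coefficients. The top
nonzero coefficient is c; it is positive because f ≥ 0, and it exists because f does not vanish
eventually. -/
theorem exists_hasGrowth {f : ℕ → ℕ} {R n₀ : ℕ}
    (h : ∀ n ≥ n₀, (fwdDiff 1)^[R] (fun n => (f n : ℤ)) n = 0) (hf : ∃ᶠ n in atTop, 0 < f n) :
    ∃ D c, D < R ∧ HasGrowth f D c := by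
  classical
  set F : ℕ → ℤ := fun n => (f n : ℤ) with hF
  set a : ℕ → ℤ := fun k => (fwdDiff 1)^[k] F n₀ with ha
  have h0 : ∀ k ≥ R, a k = 0 := by
    intro k hk
    obtain ⟨j, rfl⟩ := Nat.exists_eq_add_of_le' hk
    rw [ha]
    simp only [Function.iterate_add_apply]
    rw [fwdDiff_iter_congr (g := 0) h j n₀ le_rfl, fwdDiff_iter_eq_sum_shift]
    simp
  have hex : ∃ k, k ≤ R ∧ a k ≠ 0 := by
    by_contra! hcon
    have hz : ∀ k, a k = 0 := fun k => by
      rcases le_total k R with h | h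
      · exact hcon k h
      · exact h0 k h
    obtain ⟨n, hn, hn'⟩ := (hf.and_eventually (eventually_ge_atTop n₀)).exists
    obtain ⟨j, rfl⟩ := Nat.exists_eq_add_of_le hn'
    have h1 := shift_eq_sum_fwdDiff_iter 1 F j n₀
    rw [Finset.sum_eq_zero (fun k _ => by rw [hz k |> (show (fwdDiff 1)^[k] F n₀ = 0 from ·), smul_zero])] at h1
    simp only [smul_eq_mul, mul_one, hF] at h1
    omega
  obtain ⟨k, hk, hak⟩ := hex
  set D := Nat.findGreatest (fun k => a k ≠ 0) R with hD
  have haD : a D ≠ 0 := Nat.findGreatest_spec (P := fun k => a k ≠ 0) hk hak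
  have hDR : D < R := by
    by_contra hcon
    exact haD (h0 _ (not_lt.mp hcon))
  have hgt : ∀ k > D, a k = 0 := fun k hk => by
    rcases le_total k R with h | h
    · simpa using Nat.findGreatest_is_greatest hk h
    · exact h0 k h
  have hnewton : ∀ n, F (n + n₀) = ∑ k ∈ Finset.range (D + 1), (n.choose k : ℤ) * a k := by
    intro n
    have h1 := shift_eq_sum_fwdDiff_iter 1 F n n₀
    rw [smul_eq_mul, mul_one, add_comm] at h1
    rw [h1, Finset.sum_subset (Finset.range_subset_range.mpr (le_max_left (n + 1) (D + 1))),
      Finset.sum_subset (Finset.range_subset_range.mpr (le_max_right (n + 1) (D + 1)))]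
    · exact Finset.sum_congr rfl fun k _ => by rw [nsmul_eq_mul]
    · intro k _ hk
      rw [hgt k (by simpa using hk), mul_zero]
    · intro k _ hk
      rw [Nat.choose_eq_zero_of_lt (by simpa using hk), zero_smul]
  have hlim : Tendsto (fun n : ℕ => (f n : ℝ) / (n : ℝ) ^ D) atTop (𝓝 (a D / D.factorial)) := by
    apply tendsto_div_pow_of_shift (b := n₀) (u := fun n => (f n : ℝ))
    have h2 : ∀ n, (f (n + n₀) : ℝ) / (n : ℝ) ^ D =
        ∑ k ∈ Finset.range (D + 1), (n.choose k : ℝ) / (n : ℝ) ^ D * a k := by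
      intro n
      have h3 : (f (n + n₀) : ℝ) = ((F (n + n₀) : ℤ) : ℝ) := by simp [hF]
      rw [h3, hnewton, Int.cast_sum, Finset.sum_div]
      refine Finset.sum_congr rfl fun k _ => ?_
      push_cast
      ring
    simp_rw [h2]
    have h3 := tendsto_finsetSum (Finset.range (D + 1)) fun k hk =>
      (tendsto_choose_div_pow (Nat.lt_succ_iff.mp (Finset.mem_range.mp hk))).mul_const (a k : ℝ)
    refine h3.congr_lim ?_
    rw [Finset.sum_eq_single D (fun k _ hk => by simp [hk]) (by simp)]
    simp only [if_true]
    ring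
  -- The factor n allows the exponent D instead of D - 1, so that D = 0 needs no separate
  -- convention.
  have hdiff : Tendsto (fun n : ℕ => ((f (n + 1) : ℝ) - f n) * n / (n : ℝ) ^ D) atTop
      (𝓝 (D * a D / D.factorial)) := by
    apply tendsto_div_pow_of_shift (b := n₀) (u := fun n : ℕ => ((f (n + 1) : ℝ) - f n) * n)
    have h2 : ∀ n, ((f (n + n₀ + 1) : ℝ) - f (n + n₀)) =
        ∑ k ∈ Finset.range D, (n.choose k : ℝ) * a (k + 1) := by
      intro n
      have h3 : (f (n + n₀ + 1) : ℝ) - f (n + n₀) =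
          ((F (n + 1 + n₀) - F (n + n₀) : ℤ) : ℝ) := by simp [hF, add_right_comm]
      rw [h3, hnewton, hnewton, ← Finset.sum_sub_distrib, Finset.sum_range_succ', Int.cast_add,
        Int.cast_sum]
      simp only [Nat.choose_succ_succ]
      push_cast
      simp only [Nat.choose_zero_right, sub_self, add_zero]
      refine Finset.sum_congr rfl fun k _ => ?_
      ring
    have h4 : Tendsto (fun n : ℕ => ((f (n + n₀ + 1) : ℝ) - f (n + n₀)) * n / (n : ℝ) ^ D) atTop
        (𝓝 (D * a D / D.factorial)) := by
      rcases Nat.eq_zero_or_pos D with h0 | h0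
      · simp [h2, h0]
      obtain ⟨E, hE⟩ := Nat.exists_eq_add_of_le' h0
      rw [hE] at h2 ⊢
      have h3 := tendsto_finsetSum (Finset.range (E + 1)) fun k hk =>
        (tendsto_choose_div_pow (Nat.lt_succ_iff.mp (Finset.mem_range.mp hk))).mul_const
          (a (k + 1) : ℝ)
      rw [Finset.sum_eq_single E (fun k _ hk => by simp [hk]) (by simp), if_pos rfl] at h3
      refine (h3.congr_lim ?_).congr' ?_
      · rw [Nat.factorial_succ]
        push_cast
        field_simp
      · filter_upwards [eventually_gt_atTop 0] with n hn
        have : (n : ℝ) ≠ 0 := by positivity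
        rw [h2, Finset.sum_mul, Finset.sum_div]
        refine Finset.sum_congr rfl fun k _ => ?_
        rw [pow_succ]
        field_simp
    have h5 := h4.mul (tendsto_add_div_self n₀)
    rw [mul_one] at h5
    refine h5.congr' ?_
    filter_upwards [eventually_gt_atTop 0] with n hn
    have : (n : ℝ) ≠ 0 := by positivity
    field_simp
  have hnn : 0 ≤ (a D : ℝ) / D.factorial := ge_of_tendsto' hlim fun n => by positivity
  have hpos : 0 < a D := by
    have h1 : 0 ≤ (a D : ℝ) := by
      by_contra hcon
      have : (a D : ℝ) / D.factorial < 0 := div_neg_of_neg_of_pos (by linarith) (by positivity)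
      linarith
    have h2 : 0 ≤ a D := by exact_mod_cast h1
    omega
  have hc : ((a D).toNat : ℝ) = a D := by
    have : (((a D).toNat : ℤ) : ℝ) = a D := by rw [Int.toNat_of_nonneg hpos.le]
    rwa [Int.cast_natCast] at this
  exact ⟨D, (a D).toNat, hDR, by omega, by rwa [hc], by rwa [hc]⟩

namespace HasGrowth

variable {f g : ℕ → ℕ} {D D' c c' : ℕ}

theorem tendsto_diff_shift (hf : HasGrowth f D c) (s : ℕ) :
    Tendsto (fun n : ℕ => ((f (n + s) : ℝ) - f n) * n / (n : ℝ) ^ D) atTop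
      (𝓝 (s * (D * c / D.factorial))) := by
  induction s with
  | zero => simp
  | succ s ih =>
    have h1 := (tendsto_shift_div_pow s hf.tendsto_diff).div (tendsto_add_div_self s) one_ne_zero
    have h2 := ih.add h1
    refine (h2.congr_lim ?_).congr' ?_
    · push_cast
      ring
    · filter_upwards [eventually_gt_atTop 0] with n hn
      have : (n : ℝ) ≠ 0 := by positivity
      have : ((n + s : ℕ) : ℝ) ≠ 0 := by positivity
      simp only [Pi.div_apply, ← add_assoc]
      field_simp
      ring

theorem isTheta (hf : HasGrowth f D c) :
    (fun n => (f n : ℝ)) =Θ[atTop] fun n : ℕ => (n : ℝ) ^ D :=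
  (Asymptotics.isTheta_of_div_tendsto_nhds_ne_zero hf.tendsto (by
    have := hf.pos
    positivity)).symm

theorem isBigO_comp (hf : HasGrowth f D c) {a : ℕ} (ha : 0 < a) (b : ℕ) :
    (fun n => (f (a * n + b) : ℝ)) =O[atTop] fun n : ℕ => (n : ℝ) ^ D := by
  have ht : Tendsto (fun n : ℕ => a * n + b) atTop atTop :=
    tendsto_atTop_mono (fun n => by simp only [id]; nlinarith) tendsto_id
  refine (hf.isTheta.isBigO.comp_tendsto ht).trans ?_
  refine Asymptotics.IsBigO.of_bound (((a + b : ℕ) : ℝ) ^ D) ?_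
  filter_upwards [eventually_ge_atTop 1] with n hn
  simp only [Function.comp_apply, norm_pow, Real.norm_natCast]
  rw [← mul_pow]
  gcongr
  norm_cast
  nlinarith

theorem isBigO_diff (hf : HasGrowth f D c) (s : ℕ) :
    (fun n : ℕ => ((f (n + s) : ℝ) - f n) * n) =O[atTop] fun n : ℕ => (n : ℝ) ^ D :=
  Asymptotics.isBigO_of_div_tendsto_nhds (by
    filter_upwards [eventually_gt_atTop 0] with n hn h
    have : (n : ℝ) ^ D ≠ 0 := by positivity
    contradiction) _ (hf.tendsto_diff_shift s)

theorem isBigO_of_diff (hf : HasGrowth f (D + 1) c) :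
    (fun n : ℕ => (n : ℝ) ^ D) =O[atTop] fun n : ℕ => (f (n + 1) : ℝ) - f n := by
  have h := (Asymptotics.isTheta_of_div_tendsto_nhds_ne_zero hf.tendsto_diff (by
    have := hf.pos
    positivity)).isBigO
  have h1 := h.mul (Asymptotics.isBigO_refl (fun n : ℕ => ((n : ℝ))⁻¹) atTop)
  refine h1.congr' ?_ ?_ <;>
  · filter_upwards [eventually_gt_atTop 0] with n hn
    have : (n : ℝ) ≠ 0 := by positivity
    try rw [pow_succ]
    field_simp

end HasGrowth

theorem le_of_isBigO_pow {D D' : ℕ}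
    (h : (fun n : ℕ => (n : ℝ) ^ D) =O[atTop] fun n : ℕ => (n : ℝ) ^ D') : D ≤ D' := by
  by_contra hcon
  have h1 := (Asymptotics.isLittleO_pow_pow_atTop_of_lt (𝕜 := ℝ)
    (not_le.mp hcon)).comp_tendsto tendsto_natCast_atTop_atTop
  refine Asymptotics.isLittleO_irrefl ?_ (h1.trans_isBigO h)
  refine Eventually.frequently ?_
  filter_upwards [eventually_gt_atTop 0] with n hn
  simp only [Function.comp_apply]
  positivity

end Growth

/-! ### Dimension theory through Samuel functions -/

section Dimension

variable {A : Type*} [CommRing A] [IsNoetherianRing A]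

/-- A consequence of the Artin-Rees lemma for multiplication by `x` on the domain `A / p`. -/
theorem exists_mem_sup_pow_of_mul_mem (q p : Ideal A) [p.IsPrime] {x : A} (hx : x ∉ p) :
    ∃ c, ∀ n a, x * a ∈ p ⊔ q ^ (n + c) → a ∈ p ⊔ q ^ n := by
  obtain ⟨c, hc⟩ := q.exists_pow_inf_eq_pow_smul
    (Submodule.span A {(Ideal.Quotient.mk p x : A ⧸ p)})
  refine ⟨c, fun n a ha => ?_⟩
  obtain ⟨u, hu, v, hv, huv⟩ := Submodule.mem_sup.mp ha
  have h1 : (Ideal.Quotient.mk p (x * a) : A ⧸ p) ∈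
      q ^ (n + c) • (⊤ : Submodule A (A ⧸ p)) ⊓
        Submodule.span A {(Ideal.Quotient.mk p x : A ⧸ p)} := by
    constructor
    · rw [← huv, map_add, Ideal.Quotient.eq_zero_iff_mem.mpr hu, zero_add]
      have : (Ideal.Quotient.mk p v : A ⧸ p) = v • (1 : A ⧸ p) := by
        rw [Algebra.smul_def, mul_one]
        rfl
      rw [this]
      exact Submodule.smul_mem_smul hv trivial
    · refine Submodule.mem_span_singleton.mpr ⟨a, ?_⟩
      rw [Algebra.smul_def, mul_comm, map_mul]
      rfl
  rw [hc _ (Nat.le_add_left _ _), Nat.add_sub_cancel] at h1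
  have h2 := Submodule.smul_mono le_rfl inf_le_right h1
  obtain ⟨b, hb, hb'⟩ := Submodule.mem_smul_span_singleton.mp h2
  have h3 : x * (a - b) ∈ p := by
    rw [← Ideal.Quotient.eq_zero_iff_mem, mul_sub, map_sub, ← hb', Algebra.smul_def, sub_eq_zero,
      mul_comm x b, map_mul]
    rfl
  have h4 := (Ideal.IsPrime.mem_or_mem ‹_› h3).resolve_left hx
  rw [← sub_add_cancel a b]
  exact Submodule.add_mem_sup h4 hb

variable [IsLocalRing A]

theorem relLength_sup_pow_ne_top {q : Ideal A} {c : ℕ} (hq : maximalIdeal A ^ c ≤ q) (I : Ideal A)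
    (n : ℕ) : relLength (I ⊔ q ^ n) ⊤ ≠ ⊤ := by
  rw [relLength_top]
  refine length_quotient_ne_top (c := c * n) ?_
  rw [pow_mul]
  exact (Ideal.pow_right_mono hq n).trans le_sup_right

theorem coe_samuelLength {q : Ideal A} {c : ℕ} (hq : maximalIdeal A ^ c ≤ q) (I : Ideal A)
    (n : ℕ) : (samuelLength I q n : ℕ∞) = relLength (I ⊔ q ^ n) ⊤ := by
  have h := relLength_sup_pow_ne_top hq I n
  rw [relLength_top] at h ⊢
  exact ENat.natCast_toNat h

theorem samuelLength_pos {I q : Ideal A} {c : ℕ} (hq : maximalIdeal A ^ c ≤ q) (hI : I ≠ ⊤)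
    (hq' : q ≤ maximalIdeal A) {n : ℕ} (hn : 0 < n) : 0 < samuelLength I q n := by
  have h : I ⊔ q ^ n ≠ ⊤ := fun h => by
    have : I ⊔ q ^ n ≤ maximalIdeal A :=
      sup_le (le_maximalIdeal hI) ((Ideal.pow_le_self hn.ne').trans hq')
    rw [h, top_le_iff] at this
    exact (maximalIdeal.isMaximal A).ne_top this
  have h1 : (samuelLength I q n : ℕ∞) ≠ 0 := by
    rw [coe_samuelLength hq, relLength_top, ne_eq, Module.length_eq_zero_iff,
      Submodule.Quotient.subsingleton_iff]
    exact h
  exact Nat.pos_of_ne_zero (by exact_mod_cast h1)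

theorem samuelLength_anti {I J q q' : Ideal A} {c : ℕ} (hq : maximalIdeal A ^ c ≤ q) {n n' : ℕ}
    (h : I ⊔ q ^ n ≤ J ⊔ q' ^ n') : samuelLength J q' n' ≤ samuelLength I q n := by
  have h1 := relLength_sup_pow_ne_top hq I n
  simp only [samuelLength, ← relLength_top]
  exact ENat.toNat_le_toNat (relLength_mono le_rfl h) h1

theorem exists_hasGrowth_samuelLength {I q : Ideal A} {c : ℕ} (hq : maximalIdeal A ^ c ≤ q)
    (hI : I ≠ ⊤) (hq' : q ≤ maximalIdeal A) {s : Finset A} (hs : Ideal.span (s : Set A) = q) :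
    ∃ D e, D ≤ s.card ∧ HasGrowth (samuelLength I q) D e := by
  obtain ⟨n₀, h⟩ := exists_fwdDiff_iter_samuelLength_eq_zero I q hq
    (fun i => (s.equivFin.symm i : A)) (by
      rw [← hs]
      congr 1
      ext a
      simp only [Set.mem_range, Finset.mem_coe]
      exact ⟨fun ⟨i, hi⟩ => hi ▸ (s.equivFin.symm i).2, fun ha => ⟨s.equivFin ⟨a, ha⟩, by simp⟩⟩)
  obtain ⟨D, e, hD, hg⟩ := exists_hasGrowth h (Eventually.frequently
    ((eventually_gt_atTop 0).mono fun n hn => samuelLength_pos hq hI hq' hn))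
  exact ⟨D, e, Nat.lt_succ_iff.mp hD, hg⟩

theorem exists_hasGrowth_samuelLength_maximalIdeal {I : Ideal A} (hI : I ≠ ⊤) :
    ∃ D e, HasGrowth (samuelLength I (maximalIdeal A)) D e := by
  obtain ⟨s, hs⟩ := IsNoetherian.noetherian (maximalIdeal A)
  obtain ⟨D, e, -, h⟩ := exists_hasGrowth_samuelLength (c := 1) (by simp) hI le_rfl hs
  exact ⟨D, e, h⟩

/-- Multiplication by x maps A onto (p + (x)) / p, and `hc` makes A / (p + 𝔪^n) a quotient of (p +
(x) + 𝔪^(n+c)) / (p + 𝔪^(n+c)). -/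
theorem samuelLength_add_le {p : Ideal A} {x : A} {c : ℕ}
    (hc : ∀ n a, x * a ∈ p ⊔ maximalIdeal A ^ (n + c) → a ∈ p ⊔ maximalIdeal A ^ n) (n : ℕ) :
    samuelLength (p ⊔ Ideal.span {x}) (maximalIdeal A) (n + c) +
      samuelLength p (maximalIdeal A) n ≤ samuelLength p (maximalIdeal A) (n + c) := by
  set m := maximalIdeal A with hm
  have hq : m ^ 1 ≤ m := by simp
  have h1 : p ⊔ m ^ (n + c) ≤ p ⊔ Ideal.span {x} ⊔ m ^ (n + c) :=
    sup_le_sup_right le_sup_left _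
  have h2 : relLength (p ⊔ m ^ n) ⊤ ≤
      relLength (p ⊔ m ^ (n + c)) (p ⊔ Ideal.span {x} ⊔ m ^ (n + c)) := by
    refine relLength_le_of_map_le (LinearMap.mulLeft A x) ?_ fun a _ ha => hc n a ha
    rintro _ ⟨a, -, rfl⟩
    exact Submodule.mem_sup_left (Submodule.mem_sup_right
      (Ideal.mul_mem_right _ _ (Ideal.mem_span_singleton_self x)))
  have h3 := relLength_add h1 le_top
  rw [← coe_samuelLength hq, ← coe_samuelLength hq] at h3
  rw [← coe_samuelLength hq] at h2
  have h4 : ((samuelLength (p ⊔ Ideal.span {x}) m (n + c) + samuelLength p m n : ℕ) : ℕ∞) ≤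
      (samuelLength p m (n + c) : ℕ∞) := by
    rw [← h3, Nat.cast_add, add_comm]
    gcongr
  exact_mod_cast h4

/-- For x ∈ p' outside p, the Samuel function of p' is bounded by H(n+c) - H(n), where H is that of
p and c is the Artin-Rees constant. This difference has degree at most D - 1. -/
theorem HasGrowth.succ_le_of_lt {p p' : Ideal A} [p.IsPrime] [p'.IsPrime] (hp : p < p')
    {D D' e e' : ℕ} (h : HasGrowth (samuelLength p (maximalIdeal A)) D e)
    (h' : HasGrowth (samuelLength p' (maximalIdeal A)) D' e') : D' + 1 ≤ D := by
  obtain ⟨x, hx', hx⟩ := SetLike.exists_of_lt hp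
  obtain ⟨c, hc⟩ := exists_mem_sup_pow_of_mul_mem (maximalIdeal A) p hx
  have hle : p ⊔ Ideal.span {x} ≤ p' := by
    rw [sup_le_iff, Ideal.span_singleton_le_iff_mem]
    exact ⟨hp.le, hx'⟩
  apply le_of_isBigO_pow
  refine Asymptotics.IsBigO.trans ?_ (h.isBigO_diff c)
  have h1 := (h'.isTheta.symm.isBigO).mul (Asymptotics.isBigO_refl (fun n : ℕ => (n : ℝ)) atTop)
  refine (h1.congr_left fun n => (pow_succ _ _).symm).trans ?_
  refine Asymptotics.IsBigO.of_norm_le fun n => ?_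
  rw [Real.norm_of_nonneg (by positivity)]
  gcongr
  have h2 : samuelLength p' (maximalIdeal A) n ≤
      samuelLength (p ⊔ Ideal.span {x}) (maximalIdeal A) (n + c) := by
    refine samuelLength_anti (c := 1) (by simp) ?_
    exact sup_le_sup hle (Ideal.pow_le_pow_right (Nat.le_add_right _ _))
  have h3 := samuelLength_add_le hc n
  have h4 : ((samuelLength p' (maximalIdeal A) n + samuelLength p (maximalIdeal A) n : ℕ) : ℝ) ≤
      samuelLength p (maximalIdeal A) (n + c) := by
    exact_mod_cast (by omega)
  push_cast at h4
  linarith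

theorem length_le_of_hasGrowth (l : ℕ) : ∀ s : LTSeries (PrimeSpectrum A), s.length = l →
    ∀ {D e : ℕ}, HasGrowth (samuelLength s.head.asIdeal (maximalIdeal A)) D e → l ≤ D := by
  induction l with
  | zero => intro s _ D e _; exact Nat.zero_le D
  | succ l ih =>
    intro s hs D e h
    have h0 : s.length ≠ 0 := by omega
    obtain ⟨D', e', h'⟩ := exists_hasGrowth_samuelLength_maximalIdeal
      (I := (s.tail h0).head.asIdeal) (Ideal.IsPrime.ne_top inferInstance)
    have h1 := ih (s.tail h0) (by simp [hs]) h'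
    have h2 : s.head < (s.tail h0).head := by
      rw [RelSeries.head_tail]
      exact s.strictMono (by simp [Fin.lt_def, hs])
    have := h.succ_le_of_lt h2 h'
    omega

/-- A longest chain of primes forces the degree to be at least the dimension, since degrees drop
strictly along it. Conversely, 𝔪 is minimal over an ideal generated by height-many elements. That
ideal contains a power of 𝔪, and its Samuel function dominates that of 𝔪 and has degree at most the
number of generators. -/
theorem natKrullDim_eq_of_hasGrowth [IsDomain A] {D e : ℕ}
    (h : HasGrowth (samuelLength (⊥ : Ideal A) (maximalIdeal A)) D e) : natKrullDim A = D := by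
  have hdim : (natKrullDim A : ℕ∞) = (maximalIdeal A).height := by
    rw [natKrullDim, ← maximalIdeal_height_eq_ringKrullDim, WithBot.unbotD_coe]
    exact ENat.natCast_toNat (Ideal.height_ne_top (Ideal.IsPrime.ne_top inferInstance))
  apply le_antisymm
  · obtain ⟨s, -, hs⟩ := Ideal.exists_ltSeries_length_eq_height (maximalIdeal A)
    rw [← hdim] at hs
    obtain ⟨D', e', h'⟩ := exists_hasGrowth_samuelLength_maximalIdeal
      (I := s.head.asIdeal) (Ideal.IsPrime.ne_top inferInstance)
    have h1 := length_le_of_hasGrowth (natKrullDim A) s (by exact_mod_cast hs) h'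
    refine h1.trans (le_of_isBigO_pow ?_)
    refine (h'.isTheta.symm.isBigO.trans ?_).trans h.isTheta.isBigO
    refine Asymptotics.IsBigO.of_norm_le fun n => ?_
    rw [Real.norm_natCast]
    exact_mod_cast samuelLength_anti (c := 1) (by simp) (sup_le_sup_right bot_le _)
  · obtain ⟨s, hs, hcard⟩ := Ideal.exists_finset_card_eq_height_of_isNoetherianRing (maximalIdeal A)
    rw [← hdim] at hcard
    have hcard' : s.card = natKrullDim A := by exact_mod_cast hcard
    have := quotient_artinian_of_mem_minimalPrimes_of_isLocalRing _ hs
    obtain ⟨c, hc⟩ := exists_maximalIdeal_pow_le_of_isArtinianRing_quotient (Ideal.span (s : Set A))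
    obtain ⟨D', e', hD', h'⟩ := exists_hasGrowth_samuelLength (I := ⊥) hc bot_ne_top hs.1.2 rfl
    rw [← hcard']
    refine le_trans (le_of_isBigO_pow ?_) hD'
    refine (h.isTheta.symm.isBigO.trans ?_).trans h'.isTheta.isBigO
    refine Asymptotics.IsBigO.of_norm_le fun n => ?_
    rw [Real.norm_natCast]
    exact_mod_cast samuelLength_anti hc (sup_le_sup_left (Ideal.pow_right_mono hs.1.2 n) _)

end Dimension

/-! ### Stabilization over a factorial ring -/

section AlmostIntegral

theorem dvd_of_forall_prime_exists_not_dvd {S : Type*} [CommRing S] [IsDomain S]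
    [UniqueFactorizationMonoid S] {b : S} (hb : b ≠ 0) :
    ∀ {a : S}, (∀ p, Prime p → ∃ b', ¬ p ∣ b' ∧ b ∣ b' * a) → b ∣ a := by
  induction b using UniqueFactorizationMonoid.induction_on_prime with
  | h₁ => exact absurd rfl hb
  | h₂ b hu => exact fun _ => hu.dvd
  | h₃ b p hb0 hp ih =>
    intro a ha
    obtain ⟨b', hb', hd⟩ := ha p hp
    obtain ⟨a, rfl⟩ := (hp.dvd_or_dvd ((dvd_mul_right p b).trans hd)).resolve_left hb'
    refine mul_dvd_mul_left p (ih hb0 fun q hq => ?_)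
    obtain ⟨c, hc, hd⟩ := ha q hq
    refine ⟨c, hc, ?_⟩
    rw [mul_left_comm] at hd
    exact (mul_dvd_mul_iff_left hp.ne_zero).mp hd

/-- A free module over a factorial ring is the intersection of its localizations at the principal
primes. Coordinatewise, a fraction whose denominator can be chosen prime to each p is integral. -/
theorem mem_span_range_of_forall_prime {S L ι : Type*} [CommRing S] [IsDomain S]
    [UniqueFactorizationMonoid S] [AddCommGroup L] [Module S L] [Module.IsTorsionFree S L] [Fintype ι]
    {v : ι → L} (hv : LinearIndependent S v) {h : L}
    (h0 : ∃ b : S, b ≠ 0 ∧ b • h ∈ Submodule.span S (Set.range v))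
    (h1 : ∀ p : S, Prime p → ∃ b : S, ¬ p ∣ b ∧ b • h ∈ Submodule.span S (Set.range v)) :
    h ∈ Submodule.span S (Set.range v) := by
  obtain ⟨b, hb, hbh⟩ := h0
  obtain ⟨a, ha⟩ := (Submodule.mem_span_range_iff_exists_fun S).mp hbh
  have hd : ∀ j, b ∣ a j := by
    intro j
    refine dvd_of_forall_prime_exists_not_dvd hb fun p hp => ?_
    obtain ⟨b', hb', hbh'⟩ := h1 p hp
    obtain ⟨a', ha'⟩ := (Submodule.mem_span_range_iff_exists_fun S).mp hbh'
    have h2 : ∑ i, (b' * a i) • v i = ∑ i, (b * a' i) • v i := by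
      simp_rw [mul_smul, ← Finset.smul_sum, ha, ha', smul_smul, mul_comm]
    rw [← sub_eq_zero, ← Finset.sum_sub_distrib] at h2
    simp_rw [← sub_smul] at h2
    exact ⟨b', hb', a' j, sub_eq_zero.mp (Fintype.linearIndependent_iff.mp hv _ h2 j)⟩
  choose d hd using hd
  have h3 : h = ∑ i, d i • v i := by
    apply smul_right_injective L hb
    simp only [← ha, Finset.smul_sum, smul_smul, ← hd]
  rw [h3]
  exact Submodule.sum_mem _ fun i _ =>
    Submodule.smul_mem _ _ (Submodule.subset_span ⟨i, rfl⟩)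

/-- Let `G` be a domain that is finite over a Noetherian factorial domain `S`, and `P` an ideal
of `G` whose contraction to `S` lies in no principal proper ideal. If the `K n` are ideals
with `x * K n ⊆ K (n + 1)` whose elements are multiplied into `(x ^ n)` by powers of elements
of `P`, then `K (n + 1) ⊆ x * K n` for some `n`. -/
theorem exists_eq_mul_of_pow_mul_mem_span {S G : Type*} [CommRing S] [IsDomain S]
    [UniqueFactorizationMonoid S] [IsNoetherianRing S] [CommRing G] [IsDomain G] [Algebra S G]
    [Module.Finite S G] (hinj : Function.Injective (algebraMap S G)) {x : G} (hx : x ≠ 0)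
    {P : Ideal G} {K : ℕ → Ideal G} (hK : ∀ n, ∀ g ∈ K n, x * g ∈ K (n + 1))
    (hP : ∀ n, ∀ b ∈ P, ∀ g ∈ K n, ∃ j : ℕ, b ^ j * g ∈ Ideal.span {x ^ n})
    (hS : ∀ p : S, ¬ IsUnit p → ∃ b, algebraMap S G b ∈ P ∧ ¬ p ∣ b) :
    ∃ n, ∀ g ∈ K (n + 1), ∃ g' ∈ K n, g = x * g' := by
  classical
  let L := FractionRing G
  have hSL : Function.Injective (algebraMap S L) := by
    rw [IsScalarTower.algebraMap_eq S G L]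
    exact (IsFractionRing.injective G L).comp hinj
  have : Module.IsTorsionFree S L := Module.isTorsionFree_iff_algebraMap_injective.mpr hSL
  let ψ : G →ₗ[S] L := (IsScalarTower.toAlgHom S G L).toLinearMap
  have hψ : Function.Injective ψ := IsFractionRing.injective G L
  obtain ⟨m, g, hg⟩ := Module.Finite.exists_fin (R := S) (M := G)
  obtain ⟨s, hs, hs'⟩ := exists_maximal_linearIndepOn S g
  let v : s → L := fun i => ψ (g i)
  have hv : LinearIndependent S v := 
    LinearIndependent.map' (v := fun i : s => g i) hs ψ (LinearMap.ker_eq_bot.mpr hψ)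
  -- The maximal independent family v spans a free module F, and c is a common denominator: c G ⊆ F
  -- inside the fraction field.
  obtain ⟨c, hc, hcg⟩ : ∃ c : S, c ≠ 0 ∧ ∀ u, c • ψ u ∈ Submodule.span S (Set.range v) := by
    have h1 : ∀ i, ∃ c : S, c ≠ 0 ∧ c • ψ (g i) ∈ Submodule.span S (Set.range v) := by
      intro i
      by_cases hi : i ∈ s
      · exact ⟨1, one_ne_zero, by
          rw [one_smul]
          exact Submodule.subset_span ⟨⟨i, hi⟩, rfl⟩⟩
      · obtain ⟨c, hc, hc'⟩ := hs' i hi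
        refine ⟨c, hc, ?_⟩
        have h2 := Submodule.mem_map_of_mem (f := ψ) hc'
        rw [map_smul, Submodule.map_span, ← Set.image_comp] at h2
        convert h2 using 3
        ext
        simp [v]
    choose c hc hc' using h1
    refine ⟨∏ i, c i, Finset.prod_ne_zero_iff.mpr fun i _ => hc i, fun u => ?_⟩
    have hu : u ∈ Submodule.span S (Set.range g) := hg ▸ trivial
    induction hu using Submodule.span_induction with
    | mem u hu =>
      obtain ⟨i, rfl⟩ := hu
      rw [← Finset.prod_erase_mul _ _ (Finset.mem_univ i), mul_smul]
      exact Submodule.smul_mem _ _ (hc' i)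
    | zero => simp
    | add u u' _ _ h h' => rw [map_add, smul_add]; exact add_mem h h'
    | smul a u _ h => rw [map_smul, smul_comm]; exact Submodule.smul_mem _ _ h
  -- T n is c K n / x^n in the fraction field. The inclusions x * K n ⊆ K (n + 1) make these modules
  -- increase.
  let T : ℕ → Submodule S L := fun n =>
    { carrier := {h | ∃ g ∈ K n, (ψ x) ^ n * h = c • ψ g}
      add_mem' := by
        rintro a b ⟨g, hg, ha⟩ ⟨g', hg', hb⟩
        exact ⟨g + g', add_mem hg hg', by rw [mul_add, ha, hb, map_add, smul_add]⟩
      zero_mem' := ⟨0, zero_mem _, by simp⟩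
      smul_mem' := by
        rintro r a ⟨g, hg, ha⟩
        refine ⟨r • g, ?_, by rw [mul_smul_comm, ha, map_smul, smul_comm]⟩
        rw [Algebra.smul_def]
        exact Ideal.mul_mem_left _ _ hg }
  have hψmul : ∀ a b, ψ (a * b) = ψ a * ψ b := fun a b => map_mul (algebraMap G L) a b
  have hψpow : ∀ a n, ψ (a ^ n) = ψ a ^ n := fun a n => map_pow (algebraMap G L) a n
  have hψx : ψ x ≠ 0 := fun h => hx (hψ (h.trans (map_zero ψ).symm))
  have hT : Monotone T := monotone_nat_of_le_succ fun n h ⟨g, hg, hh⟩ =>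
    ⟨x * g, hK n g hg, by rw [pow_succ', mul_assoc, hh, hψmul, mul_smul_comm]⟩
  -- If b^j g = x^n u, then b^j (c g / x^n) = c u lies in F, and b may be taken outside any given
  -- prime (p).
  have hTF : ∀ n, T n ≤ Submodule.span S (Set.range v) := by
    rintro n h ⟨g, hg, hh⟩
    have key : ∀ p : S, ¬ IsUnit p → ∃ b : S, ¬ p ∣ b ∧ ∃ j : ℕ,
        b ^ j • h ∈ Submodule.span S (Set.range v) := by
      intro p hp
      obtain ⟨b, hbP, hb⟩ := hS p hp
      obtain ⟨j, hj⟩ := hP n _ hbP g hg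
      obtain ⟨u, hu⟩ := Ideal.mem_span_singleton.mp hj
      refine ⟨b, hb, j, ?_⟩
      convert hcg u using 1
      apply mul_left_cancel₀ (pow_ne_zero n hψx)
      rw [mul_smul_comm, hh, smul_comm, ← map_smul, Algebra.smul_def (b ^ j) g, map_pow, hu, hψmul, hψpow,
        mul_smul_comm]
    refine mem_span_range_of_forall_prime hv ?_ fun p hp => ?_
    -- The nonunit p = 0 supplies a nonzero denominator.
    · obtain ⟨b, hb, j, hj⟩ := key 0 not_isUnit_zero
      exact ⟨b ^ j, pow_ne_zero _ fun h => hb (h ▸ dvd_rfl), hj⟩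
    · obtain ⟨b, hb, j, hj⟩ := key p hp.not_isUnit
      exact ⟨b ^ j, fun h => hb (hp.dvd_of_dvd_pow h), hj⟩
  have hN : IsNoetherian S (Submodule.span S (Set.range v)) :=
    isNoetherian_span_of_finite S (Set.finite_range v)
  obtain ⟨n, hn⟩ := monotone_stabilizes_iff_noetherian.mpr hN
    ⟨fun n => (T n).comap (Submodule.subtype _), fun i j h => Submodule.comap_mono (hT h)⟩
  refine ⟨n, fun g hg => ?_⟩
  have h1 : c • ψ g / (ψ x) ^ (n + 1) ∈ T (n + 1) := ⟨g, hg, mul_div_cancel₀ _ (pow_ne_zero _ hψx)⟩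
  have h2 : (⟨_, hTF _ h1⟩ : Submodule.span S (Set.range v)) ∈
      (T (n + 1)).comap (Submodule.subtype _) := h1
  have h3 := hn (n + 1) n.le_succ
  change (T n).comap _ = (T (n + 1)).comap _ at h3
  rw [← h3] at h2
  obtain ⟨g', hg', h4⟩ := h2
  refine ⟨g', hg', hψ (smul_right_injective L hc ?_)⟩
  simp only [Submodule.subtype_apply] at h4
  simp only
  rw [hψmul, ← mul_smul_comm, ← h4, ← mul_assoc, ← pow_succ', mul_div_cancel₀ _ (pow_ne_zero _ hψx)]

end AlmostIntegral

/-! ### Length comparison for filtered finite algebras -/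

section FilteredGrowth

theorem relLength_le_length_of_ker_le {A M Q : Type*} [CommRing A] [AddCommGroup M] [Module A M]
    [AddCommGroup Q] [Module A Q] {X Y : Submodule A M} (ψ : X →ₗ[A] Q)
    (h : LinearMap.ker ψ ≤ Y.submoduleOf X) : relLength Y X ≤ Module.length A Q :=
  (Module.length_le_of_surjective (Submodule.factor h) (Submodule.factor_surjective h)).trans
    (Module.length_le_of_injective ((LinearMap.ker ψ).liftQ ψ le_rfl)
      (LinearMap.ker_eq_bot.mp (Submodule.ker_liftQ_eq_bot _ _ _ le_rfl)))

theorem relLength_pi_le {A M : Type*} [CommRing A] [AddCommGroup M] [Module A M] (m : ℕ)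
    (X Y : Submodule A M) :
    relLength (Submodule.pi Set.univ fun _ : Fin m => Y) (Submodule.pi Set.univ fun _ => X) ≤
      m * relLength Y X := by
  let ψ : Submodule.pi Set.univ (fun _ : Fin m => X) →ₗ[A] Fin m → (X ⧸ Y.submoduleOf X) :=
    LinearMap.pi fun i => (Y.submoduleOf X).mkQ.comp
      ((LinearMap.proj i).restrict (p := Submodule.pi Set.univ (fun _ : Fin m => X)) (q := X)
        fun a ha => ha i trivial)
  refine (relLength_le_length_of_ker_le ψ ?_).trans ?_
  · intro a ha i _
    have h1 := congrFun (LinearMap.mem_ker.mp ha) i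
    have h2 := (Submodule.Quotient.mk_eq_zero _).mp h1
    exact h2
  · rw [Module.length_pi_of_fintype]
    simp [relLength]

variable {A S G : Type*} [CommRing A] [CommRing S] [CommRing G] [Algebra A S] [Algebra A G]
  [Algebra S G] [IsScalarTower A S G]

/-- A comparison of lengths for an algebra `G` that is finite over `S` and filtered by
`A`-submodules `F n`, and an ideal `P` of `G` whose contraction to `S` lies in `(p)`. -/
theorem exists_relLength_le_mul_relLength [Module.Finite S G] {F : ℕ → Submodule A G}
    (hmono : Monotone F) (hfin : ∀ n, Module.length A (F n) ≠ ⊤)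
    (hF0 : F 0 ≤ 1) (hF1 : ∀ n, F (n + 1) ≤ F 1 * F n) (hF1fg : (F 1).FG)
    (hFone : 1 ≤ F 0) (hFmul : ∀ i j, F i * F j ≤ F (i + j)) (hex : ∀ g, ∃ n, g ∈ F n)
    {p : S} (hp : ∀ n g, p • g ∈ F (n + 1) → ∃ g' ∈ F n, p • g = p • g')
    {P : Ideal G} (hP : ∀ b, algebraMap S G b ∈ P → p ∣ b) :
    ∃ M w : ℕ, 0 < w ∧ ∀ n, relLength (F n) (F (n + 1)) ≤
      M * relLength (P.restrictScalars A) (F (w * n + 2 * w)) := by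
  classical
  obtain ⟨m, g, hg⟩ := Module.Finite.exists_fin (R := S) (M := G)
  let φ : (Fin m → S) →ₗ[A] G := (Fintype.linearCombination S g).restrictScalars A
  have hφ : Function.Surjective φ := by
    intro u
    have hu : u ∈ Submodule.span S (Set.range g) := hg ▸ trivial
    obtain ⟨c, hc⟩ := (Submodule.mem_span_range_iff_exists_fun S).mp hu
    exact ⟨c, by simpa [φ, Fintype.linearCombination_apply] using hc⟩
  choose κ hκ using hφ
  obtain ⟨Z, hZ⟩ := hF1fg
  let ι : S →ₗ[A] G := (IsScalarTower.toAlgHom A S G).toLinearMap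
  -- W collects the coefficients needed to write 1 and the products of generators of F 1 with the g
  -- l. With V its span, multiplying by F 1 costs one power of V, whence F n ⊆ V^(n+1) G₀.
  let W : Finset S := (Finset.univ.image fun l => κ 1 l) ∪
    (Z ×ˢ Finset.univ ×ˢ Finset.univ).image fun t => κ (t.1 * g t.2.1) t.2.2
  let V : Submodule A S := Submodule.span A W
  let V' : Submodule A G := V.map ι
  let G₀ : Submodule A G := Submodule.span A (Set.range g)
  have hsum : ∀ u, (∀ l, κ u l ∈ V) → u ∈ V' * G₀ := by
    intro u hu
    rw [← hκ u]
    simp only [φ, LinearMap.restrictScalars_apply, Fintype.linearCombination_apply]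
    refine Submodule.sum_mem _ fun l _ => ?_
    rw [Algebra.smul_def]
    exact Submodule.mul_mem_mul ⟨_, hu l, rfl⟩ (Submodule.subset_span ⟨l, rfl⟩)
  have h0 : F 0 ≤ V' * G₀ := by
    refine hF0.trans (Submodule.one_le.mpr (hsum 1 fun l => Submodule.subset_span ?_))
    simp [W]
  have h1 : F 1 * G₀ ≤ V' * G₀ := by
    rw [← hZ, Submodule.span_mul_span, Submodule.span_le]
    rintro _ ⟨z, hz, _, ⟨l, rfl⟩, rfl⟩
    refine hsum _ fun l' => Submodule.subset_span ?_
    rw [Finset.mem_coe, Finset.mem_union, Finset.mem_image, Finset.mem_image]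
    exact Or.inr ⟨(z, l, l'), by simpa using hz, rfl⟩
  have hFV : ∀ n, F n ≤ V' ^ (n + 1) * G₀ := by
    intro n
    induction n with
    | zero => simpa using h0
    | succ n ih =>
      calc F (n + 1) ≤ F 1 * F n := hF1 n
        _ ≤ F 1 * (V' ^ (n + 1) * G₀) := mul_le_mul' le_rfl ih
        _ = V' ^ (n + 1) * (F 1 * G₀) := mul_left_comm _ _ _
        _ ≤ V' ^ (n + 1) * (V' * G₀) := mul_le_mul' le_rfl h1
        _ = V' ^ (n + 1 + 1) * G₀ := by rw [pow_succ V' (n + 1), mul_assoc]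
  have hVpow : ∀ n, V' ^ n = (V ^ n).map ι := fun n =>
    (Submodule.map_pow V (IsScalarTower.toAlgHom A S G) n).symm
  have hFφ : ∀ n, F n ≤ (Submodule.pi Set.univ fun _ => V ^ (n + 1)).map φ := by
    intro n
    refine (hFV n).trans (Submodule.mul_le.mpr ?_)
    rw [hVpow]
    rintro _ ⟨u, hu, rfl⟩ b hb
    induction hb using Submodule.span_induction with
    | mem b hb =>
      obtain ⟨l, rfl⟩ := hb
      refine ⟨Pi.single l u, fun i _ => ?_, ?_⟩
      · rcases eq_or_ne i l with rfl | hi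
        · simpa using hu
        · simp [hi]
      · simp [φ, Fintype.linearCombination_apply_single, Algebra.smul_def, ι]
    | zero => simp
    | add b b' _ _ h h' => rw [mul_add]; exact add_mem h h'
    | smul a b _ h => rw [mul_smul_comm]; exact Submodule.smul_mem _ _ h
  -- S carries no grading compatible with F. The constant w bounds the filtration degree of the
  -- finitely many coefficients in W.
  obtain ⟨w, hw0, hw⟩ : ∃ w, 0 < w ∧ V' ≤ F w := by
    choose e he using hex
    refine ⟨W.sup (fun u => e (ι u)) + 1, Nat.succ_pos _, ?_⟩
    rw [Submodule.map_le_iff_le_comap, Submodule.span_le]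
    intro u hu
    exact hmono ((Finset.le_sup (f := fun u => e (ι u)) hu).trans (Nat.le_succ _)) (he (ι u))
  have hVF : ∀ n, V' ^ n ≤ F (w * n) := by
    intro n
    induction n with
    | zero => simpa using hFone
    | succ n ih =>
      rw [pow_succ, mul_add, mul_one]
      exact (mul_le_mul' ih hw).trans (hFmul _ _)
  let I : Submodule A G := (Ideal.span {algebraMap S G p}).restrictScalars A
  have hI : ∀ u, p • u ∈ I := fun u => by
    rw [Algebra.smul_def]
    exact Ideal.mul_mem_right _ _ (Ideal.mem_span_singleton_self _)
  -- By `hp`, F (n + 1) ∩ pG lies in p F n, so its length is at most that of F n. Passing to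
  -- complements inside F (n + 1) gives the bound.
  have hlenI : ∀ n, relLength (F n) (F (n + 1)) ≤ relLength I (F (n + 1)) := by
    intro n
    have e1 := relLength_add (bot_le (a := F n)) (hmono n.le_succ)
    have e2 := relLength_add (bot_le (a := I ⊓ F (n + 1))) (inf_le_right (a := I) (b := F (n + 1)))
    have e3 : relLength ⊥ (I ⊓ F (n + 1)) ≤ relLength ⊥ (F n) := by
      refine relLength_le_of_le_map (LinearMap.mulLeft A (algebraMap S G p)) ?_ (by
        rintro a - ha
        rw [Submodule.mem_bot] at ha ⊢
        rw [ha, map_zero])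
      rintro u ⟨hu, hu'⟩
      obtain ⟨t, rfl⟩ := Ideal.mem_span_singleton.mp hu
      rw [← Algebra.smul_def] at hu' ⊢
      obtain ⟨g', hg', e⟩ := hp n t hu'
      rw [e]
      exact Submodule.mem_sup_left ⟨g', hg', (Algebra.smul_def _ _).symm⟩
    have e4 : relLength (I ⊓ F (n + 1)) (F (n + 1)) ≤ relLength I (F (n + 1)) :=
      relLength_le_of_map_le LinearMap.id (by simp) fun a ha h => ⟨h, ha⟩
    have e5 : relLength ⊥ (F n) ≠ ⊤ := by
      rw [relLength_bot]
      exact hfin n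
    have e6 : relLength ⊥ (F n) + relLength (F n) (F (n + 1)) ≤
        relLength ⊥ (F n) + relLength I (F (n + 1)) := by
      rw [e1, ← e2]
      exact add_le_add e3 e4
    exact (ENat.add_le_add_iff_left e5).mp e6
  refine ⟨m, w, hw0, fun n => (hlenI n).trans ?_⟩
  let J : Submodule A S := (Ideal.span {p}).restrictScalars A
  -- G/pG is a quotient of m copies of S/(p), and S/(p) is a quotient of S/(P ∩ S), which embeds in
  -- G/P. Filtration degrees are followed through V^(n+2) ⊆ F (w(n+2)).
  calc relLength I (F (n + 1)) ≤ relLength (Submodule.pi Set.univ fun _ : Fin m => J)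
          (Submodule.pi Set.univ fun _ => V ^ (n + 2)) := by
        refine relLength_le_of_le_map φ ((hFφ (n + 1)).trans le_sup_left) fun a _ ha => ?_
        simp only [φ, LinearMap.restrictScalars_apply, Fintype.linearCombination_apply]
        refine Submodule.sum_mem _ fun l _ => ?_
        obtain ⟨t, ht⟩ := Ideal.mem_span_singleton.mp (ha l trivial)
        rw [ht, mul_smul]
        exact hI _
    _ ≤ m * relLength J (V ^ (n + 2)) := relLength_pi_le m _ _
    _ ≤ m * relLength (P.restrictScalars A) (F (w * n + 2 * w)) := by
        gcongr
        refine relLength_le_of_map_le ι ?_ fun a _ ha => Ideal.mem_span_singleton.mpr (hP a ha)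
        rw [← hVpow]
        exact (hVF _).trans (hmono (by rw [mul_add, mul_comm w 2]))

end FilteredGrowth

/-! ### The associated graded ring and initial ideals -/

namespace AssocGraded

variable {A : Type*} [CommRing A] (I : Ideal A)

/-- The associated graded ring, with a fixed choice of its ring and module structures. -/
def Gr : Type _ := AssociatedGradedRing I

noncomputable instance : CommRing (Gr I) := inferInstanceAs (CommRing (AssociatedGradedRing I))

noncomputable instance : Module A (Gr I) :=
  let M : Module A (AssociatedGradedRing I) := inferInstance
  { smul := M.smul
    one_smul := M.one_smul
    mul_smul := M.mul_smul
    smul_zero := M.smul_zero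
    smul_add := M.smul_add
    add_smul := M.add_smul
    zero_smul := M.zero_smul }

variable {I} in
/-- An element of the associated graded ring as an element of the direct sum. -/
def Gr.toDirectSum (g : Gr I) : AssociatedGradedRing I := g

/-- The class of `a ∈ I ^ n` in degree `n` of the associated graded ring. -/
noncomputable def ofPow (n : ℕ) : ↥(I ^ n) →ₗ[A] Gr I where
  toFun a := DirectSum.lof A ℕ (Piece I) n (cls I n a)
  map_add' a b := by
    rw [map_add, map_add]
    rfl
  map_smul' r a := by
    rw [map_smul, map_smul]
    rfl

/-- The component of degree `n` of an element of the associated graded ring. -/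
noncomputable def coeff (n : ℕ) : Gr I →ₗ[A] Piece I n where
  toFun g := g.toDirectSum n
  map_add' _ _ := rfl
  map_smul' _ _ := rfl

variable {I}

theorem coeff_ofPow_self {n : ℕ} (a : ↥(I ^ n)) : coeff I n (ofPow I n a) = cls I n a :=
  DirectSum.of_eq_same (β := Piece I) n (cls I n a)

theorem coeff_ofPow_of_ne {n i : ℕ} (h : i ≠ n) (a : ↥(I ^ n)) : coeff I i (ofPow I n a) = 0 :=
  DirectSum.of_eq_of_ne (β := Piece I) _ _ (cls I n a) h

theorem ofPow_mul_ofPow {i j : ℕ} (a : ↥(I ^ i)) (b : ↥(I ^ j)) :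
    ofPow I i a * ofPow I j b = ofPow I (i + j) (powMul I i j a b) :=
  DirectSum.of_mul_of _ _

theorem one_eq_ofPow : (1 : Gr I) = ofPow I 0 ⟨1, by simp⟩ := rfl

theorem ofPow_congr {i j : ℕ} (h : i = j) (a : ↥(I ^ i)) (b : ↥(I ^ j)) (hab : (a : A) = b) :
    ofPow I i a = ofPow I j b := by
  subst h
  rw [Subtype.ext hab]

theorem ofPow_eq_zero_iff {n : ℕ} (a : ↥(I ^ n)) : ofPow I n a = 0 ↔ (a : A) ∈ I ^ (n + 1) := by
  rw [← cls_eq_zero_iff]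
  constructor
  · intro h
    rw [← coeff_ofPow_self, h, map_zero]
  · intro h
    change DirectSum.lof A ℕ (Piece I) n (cls I n a) = 0
    rw [h, map_zero]

theorem exists_forall_coeff_eq_zero (g : Gr I) : ∃ n, ∀ i ≥ n, coeff I i g = 0 := by
  classical
  refine ⟨(DFinsupp.support g.toDirectSum).sup id + 1, fun i hi => ?_⟩
  by_contra h
  have := Finset.le_sup (f := id) (DFinsupp.mem_support_iff (f := g.toDirectSum).mpr h)
  simp only [id] at this
  omega

/-- An additive property of the elements with components in given submodules
can be checked on homogeneous elements. -/
theorem induction_of_forall_mem {motive : Gr I → Prop}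
    {N : ∀ i, Submodule A (Piece I i)} {g : Gr I} (hg : ∀ i, coeff I i g ∈ N i)
    (zero : motive 0) (ofPow : ∀ i a, cls I i a ∈ N i → motive (ofPow I i a))
    (add : ∀ x y, motive x → motive y → motive (x + y)) : motive g := by
  classical
  have h1 : g = ∑ i ∈ DFinsupp.support g.toDirectSum,
      (DirectSum.of (Piece I) i (g.toDirectSum i) : Gr I) :=
    (DirectSum.sum_support_of g.toDirectSum).symm
  rw [h1]
  refine Finset.sum_induction _ motive add zero fun i _ => ?_
  obtain ⟨a, ha⟩ := cls_surjective I i (coeff I i g)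
  have := ofPow i a (ha ▸ hg i)
  change motive (DirectSum.of (Piece I) i (coeff I i g))
  rw [← ha]
  exact this

theorem induction_on_ofPow {motive : Gr I → Prop} (g : Gr I)
    (zero : motive 0) (ofPow : ∀ i a, motive (ofPow I i a))
    (add : ∀ x y, motive x → motive y → motive (x + y)) : motive g :=
  induction_of_forall_mem (N := fun _ => ⊤) (fun _ => trivial) zero (fun i a _ => ofPow i a) add

theorem ext_coeff {g g' : Gr I} (h : ∀ i, coeff I i g = coeff I i g') : g = g' :=
  DFinsupp.ext (β := Piece I) (f := g.toDirectSum) (g := g'.toDirectSum) h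

theorem smul_mul_smul_aux (r : A) (x y : Gr I) : r • x * y = r • (x * y) := by
  induction x using induction_on_ofPow with
  | zero => rw [smul_zero, zero_mul, smul_zero]
  | add x x' h h' => rw [smul_add, add_mul, h, h', add_mul, smul_add]
  | ofPow i a =>
    induction y using induction_on_ofPow with
    | zero => rw [mul_zero, mul_zero, smul_zero]
    | add y y' h h' => rw [mul_add, h, h', mul_add, smul_add]
    | ofPow j b =>
      rw [← map_smul, ofPow_mul_ofPow, ofPow_mul_ofPow, ← map_smul, map_smul,
        LinearMap.smul_apply]

/-- The associated graded ring is an algebra over the base ring. -/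
noncomputable instance : Algebra A (Gr I) :=
  Algebra.ofModule smul_mul_smul_aux fun r x y => by
    rw [mul_comm, smul_mul_smul_aux, mul_comm]

theorem coeff_ofPow_mem {J : Ideal A} {n : ℕ} {a : ↥(I ^ n)} (ha : (a : A) ∈ J) (i : ℕ) :
    coeff I i (ofPow I n a) ∈ (J.submoduleOf (I ^ i)).map (cls I i) := by
  rcases eq_or_ne i n with rfl | h
  · rw [coeff_ofPow_self]
    exact ⟨a, ha, rfl⟩
  · rw [coeff_ofPow_of_ne h]
    exact zero_mem _

/-- The submodule of the elements of the associated graded ring whose components are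
initial forms of elements of an ideal `J`. -/
noncomputable def initialSubmodule (I J : Ideal A) : Submodule A (Gr I) :=
  ⨅ i, ((J.submoduleOf (I ^ i)).map (cls I i)).comap (coeff I i)

theorem mem_initialSubmodule {J : Ideal A} {g : Gr I} :
    g ∈ initialSubmodule I J ↔ ∀ i, coeff I i g ∈ (J.submoduleOf (I ^ i)).map (cls I i) := by
  simp [initialSubmodule]

theorem initialSubmodule_induction {J : Ideal A} {motive : Gr I → Prop} {g : Gr I}
    (hg : g ∈ initialSubmodule I J) (zero : motive 0)
    (ofPow : ∀ i (a : ↥(I ^ i)), (a : A) ∈ J → motive (ofPow I i a))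
    (add : ∀ x y, motive x → motive y → motive (x + y)) : motive g := by
  refine induction_of_forall_mem (mem_initialSubmodule.mp hg) zero (fun i a ha => ?_) add
  obtain ⟨b, hb, hab⟩ := ha
  have h1 : AssocGraded.ofPow I i a = AssocGraded.ofPow I i b := by
    rw [← sub_eq_zero, ← map_sub, ofPow_eq_zero_iff, ← cls_eq_zero_iff, map_sub, hab, sub_self]
  rw [h1]
  exact ofPow i b hb

theorem mul_mem_initialSubmodule_mul {J J' : Ideal A} {g g' : Gr I}
    (hg : g ∈ initialSubmodule I J) (hg' : g' ∈ initialSubmodule I J') :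
    g * g' ∈ initialSubmodule I (J * J') := by
  refine initialSubmodule_induction (motive := fun g => g * g' ∈ _) hg
    (by rw [zero_mul]; exact zero_mem _) (fun i a ha => ?_)
    fun x y hx hy => by rw [add_mul]; exact add_mem hx hy
  refine initialSubmodule_induction (motive := fun g' => ofPow I i a * g' ∈ _) hg'
    (by rw [mul_zero]; exact zero_mem _) (fun j b hb => ?_)
    fun x y hx hy => by rw [mul_add]; exact add_mem hx hy
  rw [ofPow_mul_ofPow, mem_initialSubmodule]
  exact coeff_ofPow_mem (Ideal.mul_mem_mul ha hb)

/-- The ideal of the associated graded ring generated by the initial forms of the elements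
of an ideal. -/
noncomputable def initialIdeal (I J : Ideal A) : Ideal (Gr I) where
  __ := initialSubmodule I J
  smul_mem' := fun c g hg => by
    have h := mul_mem_initialSubmodule_mul (J := ⊤) (g := c) (mem_initialSubmodule.mpr fun i => by
      obtain ⟨a, ha⟩ := cls_surjective I i (coeff I i c)
      exact ⟨a, trivial, ha⟩) hg
    rwa [Ideal.top_mul] at h

end AssocGraded

/-! ### The degree filtration and additivity of orders -/

namespace AssocGraded

variable {A : Type*} [CommRing A] {I : Ideal A}

variable (I) in
/-- The elements of degree less than `n` of the associated graded ring. -/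
noncomputable def degLT (n : ℕ) : Submodule A (Gr I) :=
  ⨅ i, ⨅ _ : n ≤ i, LinearMap.ker (coeff I i)

theorem mem_degLT {n : ℕ} {g : Gr I} : g ∈ degLT I n ↔ ∀ i, n ≤ i → coeff I i g = 0 := by
  simp [degLT]

theorem degLT_mono : Monotone (degLT I) := fun _ _ h _ hg =>
  mem_degLT.mpr fun i hi => mem_degLT.mp hg i (h.trans hi)

theorem degLT_zero : degLT I 0 = ⊥ := by
  rw [eq_bot_iff]
  intro g hg
  exact ext_coeff fun i => by rw [mem_degLT.mp hg i (Nat.zero_le i), map_zero]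

theorem exists_mem_degLT (g : Gr I) : ∃ n, g ∈ degLT I n := by
  obtain ⟨n, hn⟩ := exists_forall_coeff_eq_zero g
  exact ⟨n, mem_degLT.mpr hn⟩

theorem ofPow_mem_degLT {i n : ℕ} (h : i < n) (a : ↥(I ^ i)) : ofPow I i a ∈ degLT I n :=
  mem_degLT.mpr fun _ hj => coeff_ofPow_of_ne (by omega) a

theorem degLT_induction {n : ℕ} {motive : Gr I → Prop} {g : Gr I} (hg : g ∈ degLT I n)
    (zero : motive 0) (ofPow : ∀ i (a : ↥(I ^ i)), i < n → motive (ofPow I i a))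
    (add : ∀ x y, motive x → motive y → motive (x + y)) : motive g := by
  classical
  refine induction_of_forall_mem (N := fun i => if i < n then ⊤ else ⊥) (fun i => ?_) zero
    (fun i a ha => ?_) add
  · split_ifs with h
    · trivial
    · exact mem_degLT.mp hg i (not_lt.mp h)
  · split_ifs at ha with h
    · exact ofPow i a h
    · rw [Submodule.mem_bot, cls_eq_zero_iff, ← ofPow_eq_zero_iff] at ha
      rw [ha]
      exact zero

theorem mul_mem_degLT {a b : ℕ} {g g' : Gr I} (hg : g ∈ degLT I a) (hg' : g' ∈ degLT I (b + 1)) :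
    g * g' ∈ degLT I (a + b) := by
  refine degLT_induction (motive := fun g => g * g' ∈ _) hg (by rw [zero_mul]; exact zero_mem _)
    (fun i u hi => ?_) fun x y hx hy => by rw [add_mul]; exact add_mem hx hy
  refine degLT_induction (motive := fun g' => ofPow I i u * g' ∈ _) hg'
    (by rw [mul_zero]; exact zero_mem _)
    (fun j v hj => ?_) fun x y hx hy => by rw [mul_add]; exact add_mem hx hy
  rw [ofPow_mul_ofPow]
  exact ofPow_mem_degLT (by omega) _

theorem ofPow_zero_eq (a : ↥(I ^ 0)) : ofPow I 0 a = (a : A) • (1 : Gr I) := by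
  rw [one_eq_ofPow, ← map_smul]
  exact ofPow_congr rfl _ _ (by simp)

theorem degLT_one : degLT I 1 = 1 := by
  apply le_antisymm
  · intro g hg
    refine degLT_induction (motive := fun g => g ∈ (1 : Submodule A (Gr I))) hg (zero_mem _)
      (fun i u hi => ?_) fun x y hx hy => add_mem hx hy
    obtain rfl : i = 0 := by omega
    rw [ofPow_zero_eq]
    exact Submodule.smul_mem _ _ (Submodule.one_le.mp le_rfl)
  · rw [Submodule.one_le, one_eq_ofPow]
    exact ofPow_mem_degLT one_pos _

theorem ofPow_succ_mem_mul {n : ℕ} {T : Submodule A (Gr I)} (a : ↥(I ^ (n + 1)))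
    (hT : ∀ (b : ↥(I ^ 1)) (c : ↥(I ^ n)), ofPow I 1 b * ofPow I n c ∈ T) :
    ofPow I (n + 1) a ∈ T := by
  obtain ⟨a, ha⟩ := a
  have ha' : a ∈ I ^ 1 * I ^ n := by rwa [← pow_add, add_comm]
  -- The membership proof is quantified so that induction over sums of products can rebuild the
  -- element of the subtype.
  have key : ∃ h : a ∈ I ^ (n + 1), ofPow I (n + 1) ⟨a, h⟩ ∈ T := by
    induction ha' using Submodule.mul_induction_on' with
    | mem_mul_mem b hb c hc =>
      have h : b * c ∈ I ^ (n + 1) := by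
        rw [add_comm, pow_add]
        exact Ideal.mul_mem_mul hb hc
      refine ⟨h, ?_⟩
      have := hT ⟨b, hb⟩ ⟨c, hc⟩
      rw [ofPow_mul_ofPow] at this
      rwa [ofPow_congr (add_comm n 1) ⟨b * c, h⟩ (powMul I 1 n ⟨b, hb⟩ ⟨c, hc⟩) rfl]
    | add x hx y hy h h' =>
      have h1 : x ∈ I ^ (n + 1) := by rwa [add_comm, pow_add]
      have h2 : y ∈ I ^ (n + 1) := by rwa [add_comm, pow_add]
      obtain ⟨_, h⟩ := h h1
      obtain ⟨_, h'⟩ := h' h2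
      exact ⟨add_mem h1 h2, by simpa only [← map_add, AddMemClass.mk_add_mk] using add_mem h h'⟩
  exact key.2

theorem degLT_succ_le_mul (n : ℕ) : degLT I (n + 2) ≤ degLT I 2 * degLT I (n + 1) := by
  intro g hg
  refine degLT_induction (motive := fun g => g ∈ degLT I 2 * degLT I (n + 1)) hg (zero_mem _)
    (fun i u hi => ?_) fun x y hx hy => add_mem hx hy
  rcases Nat.lt_or_ge i (n + 1) with h | h
  · rw [← one_mul (ofPow I i u)]
    refine Submodule.mul_mem_mul ?_ (ofPow_mem_degLT h u)
    rw [one_eq_ofPow]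
    exact ofPow_mem_degLT two_pos _
  · obtain rfl : i = n + 1 := by omega
    exact ofPow_succ_mem_mul u fun b c =>
      Submodule.mul_mem_mul (ofPow_mem_degLT one_lt_two b) (ofPow_mem_degLT n.lt_succ_self c)

theorem degLT_succ_le_sup (n : ℕ) : degLT I (n + 1) ≤ LinearMap.range (ofPow I n) ⊔ degLT I n := by
  intro g hg
  refine degLT_induction
    (motive := fun g => g ∈ LinearMap.range (ofPow I n) ⊔ degLT I n) hg (zero_mem _)
    (fun i u hi => ?_) fun x y hx hy => add_mem hx hy
  rcases Nat.lt_or_ge i n with h | h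
  · exact Submodule.mem_sup_right (ofPow_mem_degLT h u)
  · obtain rfl : i = n := by omega
    exact Submodule.mem_sup_left ⟨u, rfl⟩

theorem degLT_fg [IsNoetherianRing A] (n : ℕ) : (degLT I n).FG := by
  induction n with
  | zero =>
    rw [degLT_zero]
    exact Submodule.fg_bot
  | succ n ih =>
    have h : degLT I (n + 1) = LinearMap.range (ofPow I n) ⊔ degLT I n := by
      refine le_antisymm (degLT_succ_le_sup n) (sup_le ?_ (degLT_mono n.le_succ))
      rintro _ ⟨a, rfl⟩
      exact ofPow_mem_degLT n.lt_succ_self a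
    rw [h]
    refine Submodule.FG.sup ?_ ih
    rw [LinearMap.range_eq_map]
    exact (IsNoetherian.noetherian (⊤ : Submodule A ↥(I ^ n))).map _

theorem relLength_degLT (n : ℕ) :
    relLength (degLT I n) (degLT I (n + 1)) = relLength (I ^ (n + 1)) (I ^ n) := by
  have h : relLength (degLT I n) (degLT I (n + 1)) =
      relLength (⊥ : Submodule A (Piece I n)) ⊤ := by
    refine relLength_eq_of_map (coeff I n) le_top ?_ fun g hg => ?_
    · intro a _
      obtain ⟨a, rfl⟩ := cls_surjective I n a
      exact Submodule.mem_sup_left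
        ⟨ofPow I n a, ofPow_mem_degLT n.lt_succ_self a, coeff_ofPow_self a⟩
    · rw [Submodule.mem_bot]
      refine ⟨fun h => mem_degLT.mpr fun i hi => ?_, fun h => mem_degLT.mp h n le_rfl⟩
      rcases hi.eq_or_lt with rfl | hi
      · exact h
      · exact mem_degLT.mp hg i hi
  rw [h, relLength_bot, Module.length_top, relLength]

theorem length_degLT_ne_top (h : ∀ n, relLength (I ^ (n + 1)) (I ^ n) ≠ ⊤) (n : ℕ) :
    Module.length A (degLT I n) ≠ ⊤ := by
  induction n with
  | zero =>
    rw [degLT_zero, ← relLength_bot, relLength_self]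
    simp
  | succ n ih =>
    rw [← relLength_bot] at ih ⊢
    rw [← relLength_add bot_le (degLT_mono n.le_succ), relLength_degLT]
    exact WithTop.add_ne_top.mpr ⟨ih, h n⟩

/-- Degree by degree: an element of I^n lying in P + I^(n+1) has its class in degree n equal to that
of an element of P. So the degree n part of G modulo the initial ideal has length at most that of (P
+ I^n) / (P + I^(n+1)). -/
theorem relLength_initialIdeal_degLT_le (P : Ideal A) (n : ℕ) :
    relLength ((initialIdeal I P).restrictScalars A) (degLT I n) ≤ relLength (P ⊔ I ^ n) ⊤ := by
  set Q := (initialIdeal I P).restrictScalars A with hQ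
  induction n with
  | zero =>
    rw [degLT_zero]
    refine (relLength_mono (bot_le (a := Q)) (le_refl Q)).trans ?_
    rw [relLength_self]
    exact zero_le
  | succ n ih =>
    rw [← relLength_sup] at ih ⊢
    have h1 : P ⊔ I ^ (n + 1) ≤ P ⊔ I ^ n :=
      sup_le_sup_left (Ideal.pow_le_pow_right n.le_succ) _
    rw [← relLength_add h1 le_top,
      ← relLength_add (le_sup_left (a := Q) (b := degLT I n))
        (sup_le_sup_left (degLT_mono n.le_succ) Q), add_comm]
    refine add_le_add ?_ ih
    refine (relLength_le_of_le_map (X := (⊤ : Submodule A ↥(I ^ n)))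
      (Y := (P ⊔ I ^ (n + 1)).submoduleOf (I ^ n)) (ofPow I n) ?_ ?_).trans
      (relLength_le_of_map_le (I ^ n).subtype ?_ fun a _ ha => ha)
    · rw [Submodule.map_top]
      refine sup_le (le_sup_of_le_right le_sup_left) ((degLT_succ_le_sup n).trans ?_)
      exact sup_le_sup_left le_sup_right _
    · intro a _ ha
      obtain ⟨p, hp, c, hc, hpc⟩ := Submodule.mem_sup.mp (show (a : A) ∈ P ⊔ I ^ (n + 1) from ha)
      have hc' : c ∈ I ^ n := Ideal.pow_le_pow_right n.le_succ hc
      have hp' : p ∈ I ^ n := by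
        rw [eq_sub_of_add_eq hpc]
        exact sub_mem a.2 hc'
      have h2 : ofPow I n a = ofPow I n ⟨p, hp'⟩ := by
        rw [← sub_eq_zero, ← map_sub, ofPow_eq_zero_iff]
        simpa [← hpc] using hc
      rw [h2]
      exact Submodule.mem_sup_left (mem_initialSubmodule.mpr (coeff_ofPow_mem hp))
    · rw [Submodule.map_top, Submodule.range_subtype]
      exact le_sup_right

theorem exists_top_coeff {n : ℕ} {g : Gr I} (hg : g ∉ degLT I n) :
    ∃ f, n ≤ f ∧ g ∈ degLT I (f + 1) ∧ coeff I f g ≠ 0 := by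
  classical
  have hex := exists_mem_degLT g
  have h1 := Nat.find_spec hex
  have h2 : n < Nat.find hex := by
    by_contra h
    exact hg (degLT_mono (not_lt.mp h) h1)
  obtain ⟨f, hf⟩ := Nat.exists_eq_add_of_lt h2
  rw [hf] at h1
  refine ⟨n + f, Nat.le_add_right _ _, h1, fun h0 => ?_⟩
  refine Nat.find_min hex (m := n + f) (by omega) (mem_degLT.mpr fun i hi => ?_)
  rcases hi.eq_or_lt with rfl | hi
  · exact h0
  · exact mem_degLT.mp h1 i hi

theorem sub_ofPow_mem_degLT {f : ℕ} {g : Gr I} (hg : g ∈ degLT I (f + 1)) {b : ↥(I ^ f)}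
    (hb : cls I f b = coeff I f g) : g - ofPow I f b ∈ degLT I f := by
  refine mem_degLT.mpr fun i hi => ?_
  rcases hi.eq_or_lt with rfl | hi
  · rw [map_sub, coeff_ofPow_self, hb, sub_self]
  · rw [map_sub, mem_degLT.mp hg i hi, coeff_ofPow_of_ne hi.ne', sub_zero]

/-- In a graded domain the top-degree forms of t and g have nonzero product, so degrees add. -/
theorem mem_degLT_of_mul_mem [IsDomain (Gr I)] {e n : ℕ} {t g : Gr I} (ht : t ∈ degLT I (e + 1))
    (ht' : coeff I e t ≠ 0) (h : t * g ∈ degLT I (e + n)) : g ∈ degLT I n := by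
  by_contra hg
  obtain ⟨f, hf, hgf, hgf'⟩ := exists_top_coeff hg
  obtain ⟨a, ha⟩ := cls_surjective I e (coeff I e t)
  obtain ⟨b, hb⟩ := cls_surjective I f (coeff I f g)
  have h1 := sub_ofPow_mem_degLT hgf hb
  have h2 := sub_ofPow_mem_degLT ht ha
  have h3 : ofPow I e a * ofPow I f b ∈ degLT I (e + f) := by
    have e1 : ofPow I e a * ofPow I f b =
        t * g - (t - ofPow I e a) * g - (g - ofPow I f b) * ofPow I e a := by ring
    rw [e1]
    refine sub_mem (sub_mem (degLT_mono (by omega) h) (mul_mem_degLT h2 hgf)) ?_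
    rw [add_comm]
    exact mul_mem_degLT h1 (ofPow_mem_degLT e.lt_succ_self a)
  have h4 : ofPow I e a * ofPow I f b = 0 := by
    rw [ofPow_mul_ofPow] at h3 ⊢
    have := mem_degLT.mp h3 _ le_rfl
    rwa [coeff_ofPow_self, cls_eq_zero_iff, ← ofPow_eq_zero_iff] at this
  rcases mul_eq_zero.mp h4 with h5 | h5
  · rw [ofPow_eq_zero_iff, ← cls_eq_zero_iff, ha] at h5
    exact ht' h5
  · rw [ofPow_eq_zero_iff, ← cls_eq_zero_iff, hb] at h5
    exact hgf' h5

section Order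

variable [IsDomain (Gr I)] {s : ℕ} {x : A}

theorem mem_pow_succ_of_mul_mem (hx : x ∈ I ^ s) (hx' : x ∉ I ^ (s + 1)) {j : ℕ} {b : A}
    (hb : b ∈ I ^ j) (h : x * b ∈ I ^ (s + j + 1)) : b ∈ I ^ (j + 1) := by
  have h1 : ofPow I s ⟨x, hx⟩ * ofPow I j ⟨b, hb⟩ = 0 := by
    rw [ofPow_mul_ofPow, ofPow_eq_zero_iff]
    exact h
  rcases mul_eq_zero.mp h1 with h2 | h2
  · exact absurd ((ofPow_eq_zero_iff _).mp h2) hx'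
  · exact (ofPow_eq_zero_iff _).mp h2

theorem mem_pow_of_mul_mem (hx : x ∈ I ^ s) (hx' : x ∉ I ^ (s + 1)) {j : ℕ} {b : A}
    (h : x * b ∈ I ^ (s + j)) : b ∈ I ^ j := by
  induction j with
  | zero => simp
  | succ j ih =>
    exact mem_pow_succ_of_mul_mem hx hx' (ih (Ideal.pow_le_pow_right (by omega) h)) h

/-- If x * b has order at least i ≥ s, then b has order at least i - s. Hence the class of x * b in
degree i is ξ times the class of b in degree i - s. -/
theorem initialIdeal_span_mul_le (hx : x ∈ I ^ s) (hx' : x ∉ I ^ (s + 1)) (J : Ideal A) :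
    initialIdeal I (Ideal.span {x} * J) ≤ Ideal.span {ofPow I s ⟨x, hx⟩} * initialIdeal I J := by
  intro g hg
  refine initialSubmodule_induction
    (motive := fun g => g ∈ Ideal.span {ofPow I s ⟨x, hx⟩} * initialIdeal I J) hg (zero_mem _)
    (fun i a ha => ?_) fun x y hx hy => add_mem hx hy
  obtain ⟨b, hb, hab⟩ := Ideal.mem_span_singleton_mul.mp ha
  rcases Nat.lt_or_ge i s with hi | hi
  · have h0 : ofPow I i a = 0 := by
      rw [ofPow_eq_zero_iff, ← hab]
      exact Ideal.mul_mem_right _ _ (Ideal.pow_le_pow_right hi hx)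
    rw [h0]
    exact zero_mem _
  · obtain ⟨j, rfl⟩ := Nat.exists_eq_add_of_le hi
    have hbj : b ∈ I ^ j := mem_pow_of_mul_mem hx hx' (by rw [hab]; exact a.2)
    have e : ofPow I (s + j) a = ofPow I s ⟨x, hx⟩ * ofPow I j ⟨b, hbj⟩ := by
      rw [ofPow_mul_ofPow]
      exact ofPow_congr rfl _ _ hab.symm
    rw [e]
    exact Ideal.mul_mem_mul (Ideal.mem_span_singleton_self _)
      (mem_initialSubmodule.mpr (coeff_ofPow_mem hb))

theorem initialIdeal_span_pow_le (hx : x ∈ I ^ s) (hx' : x ∉ I ^ (s + 1)) (n : ℕ) :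
    initialIdeal I (Ideal.span {x ^ n}) ≤ Ideal.span {ofPow I s ⟨x, hx⟩ ^ n} := by
  rw [← Ideal.span_singleton_pow, ← Ideal.span_singleton_pow]
  induction n with
  | zero => simp
  | succ n ih =>
    rw [pow_succ', pow_succ']
    exact (initialIdeal_span_mul_le hx hx' _).trans (Ideal.mul_mono_right ih)

end Order

end AssocGraded

/-! ### The initial ideal of a prime containing x -/

theorem mem_of_forall_mem_sup_pow {A : Type*} [CommRing A] [IsLocalRing A] [IsNoetherianRing A]
    (P : Ideal A) {z : A} (h : ∀ n, z ∈ P ⊔ maximalIdeal A ^ n) : z ∈ P := by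
  rw [← Ideal.Quotient.eq_zero_iff_mem, ← Submodule.mem_bot A,
    ← Ideal.iInf_pow_smul_eq_bot_of_isLocalRing (M := A ⧸ P) (maximalIdeal A)
      (Ideal.IsPrime.ne_top inferInstance), Submodule.mem_iInf]
  intro n
  obtain ⟨p, hp, c, hc, rfl⟩ := Submodule.mem_sup.mp (h n)
  rw [map_add, Ideal.Quotient.eq_zero_iff_mem.mpr hp, zero_add]
  have : (Ideal.Quotient.mk P c : A ⧸ P) = c • (1 : A ⧸ P) := by
    rw [Algebra.smul_def, mul_one]
    rfl
  rw [this]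
  exact Submodule.smul_mem_smul hc trivial

namespace AssocGraded

variable {A : Type*} [CommRing A]

theorem finiteType_gr [IsNoetherianRing A] (I : Ideal A) : Algebra.FiniteType A (Gr I) := by
  obtain ⟨Z, hZ⟩ := degLT_fg (I := I) 2
  refine ⟨⟨Z, eq_top_iff.mpr ?_⟩⟩
  have h1 : degLT I 2 ≤ Subalgebra.toSubmodule (Algebra.adjoin A (Z : Set (Gr I))) := by
    rw [← hZ]
    exact Algebra.span_le_adjoin A _
  intro g _
  induction g using induction_on_ofPow with
  | zero => exact zero_mem _
  | add x y hx hy => exact add_mem (hx trivial) (hy trivial)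
  | ofPow i a =>
    clear * - h1
    induction i with
    | zero => exact h1 (ofPow_mem_degLT two_pos a)
    | succ n ih =>
      exact ofPow_succ_mem_mul (T := Subalgebra.toSubmodule (Algebra.adjoin A (Z : Set (Gr I)))) a
        fun b c => (Algebra.adjoin A (Z : Set (Gr I))).mul_mem (h1 (ofPow_mem_degLT one_lt_two b)) (ih c)

variable [IsLocalRing A]

noncomputable instance : Algebra (ResidueField A) (Gr (maximalIdeal A)) :=
  (Ideal.Quotient.lift (maximalIdeal A) (algebraMap A (Gr (maximalIdeal A))) fun a ha => by
    rw [Algebra.algebraMap_eq_smul_one, ← ofPow_zero_eq ⟨a, by simp⟩, ofPow_eq_zero_iff]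
    simpa using ha).toAlgebra

instance : IsScalarTower A (ResidueField A) (Gr (maximalIdeal A)) :=
  IsScalarTower.of_algebraMap_eq fun _ => rfl

variable [IsNoetherianRing A]

/-- If `K n` is the ideal of initial forms of `(x ^ n : P ^ (k * n))`, then `K (n + 1)` is never
contained in `x * K n`, provided that `P ^ k * y ⊆ (x)` for some `y ∉ P`. -/
theorem exists_mem_initialIdeal_colon_not_mul [IsDomain (Gr (maximalIdeal A))] {s : ℕ} {x : A}
    (hx : x ∈ maximalIdeal A ^ s) {P : Ideal A} [P.IsPrime] (hxP : x ∈ P) {y : A} (hy : y ∉ P)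
    {k : ℕ} (hk : ∀ b ∈ P ^ k, y * b ∈ Ideal.span {x}) (n : ℕ) :
    ∃ g ∈ initialIdeal (maximalIdeal A)
        ((Ideal.span {x ^ (n + 1)}).colon (P ^ (k * (n + 1)) : Ideal A)),
      ∀ g' ∈ initialIdeal (maximalIdeal A) ((Ideal.span {x ^ n}).colon (P ^ (k * n) : Ideal A)),
        g ≠ ofPow (maximalIdeal A) s ⟨x, hx⟩ * g' := by
  set m := maximalIdeal A with hm
  set J : ℕ → Ideal A := fun n => (Ideal.span {x ^ n}).colon (P ^ (k * n) : Ideal A) with hJ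
  by_contra! hcon
  change ∀ g ∈ initialIdeal m (J (n + 1)), ∃ g' ∈ initialIdeal m (J n), _ at hcon
  have hyJ : ∀ n, y ^ n ∈ J n := by
    intro n
    rw [hJ, Submodule.mem_colon]
    have h1 : Ideal.span {y} * P ^ k ≤ Ideal.span {x} := by
      rw [Ideal.span_singleton_mul_le_iff]
      exact hk
    have h2 := Ideal.pow_right_mono h1 n
    rw [mul_pow, ← pow_mul, Ideal.span_singleton_pow, Ideal.span_singleton_pow] at h2
    intro b hb
    exact h2 (Ideal.mul_mem_mul (Ideal.mem_span_singleton_self _) hb)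
  have hxJ : ∀ u ∈ J n, x * u ∈ J (n + 1) := by
    intro u hu
    rw [hJ, Submodule.mem_colon] at hu ⊢
    intro b hb
    rw [smul_eq_mul, mul_assoc, pow_succ', ← Ideal.span_singleton_mul_span_singleton]
    exact Ideal.mul_mem_mul (Ideal.mem_span_singleton_self _)
      (hu b (Ideal.pow_le_pow_right (Nat.mul_le_mul_left k n.le_succ) hb))
  -- Successive approximation: the error lies in 𝔪^i and in J (n + 1), so its class in degree i is
  -- that of some x * u' with u' ∈ J n. Adding u' to u raises the order of the error by one.
  have key : ∀ i, ∃ u ∈ J n, y ^ (n + 1) - x * u ∈ m ^ i := by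
    intro i
    induction i with
    | zero => exact ⟨0, zero_mem _, by simp⟩
    | succ i ih =>
      obtain ⟨u, hu, hi⟩ := ih
      have h1 : y ^ (n + 1) - x * u ∈ J (n + 1) := sub_mem (hyJ _) (hxJ u hu)
      obtain ⟨g', hg', hgg'⟩ := hcon (ofPow m i ⟨_, hi⟩)
        (mem_initialSubmodule.mpr (coeff_ofPow_mem h1))
      have h2 := mul_mem_initialSubmodule_mul (mem_initialSubmodule.mpr
        (coeff_ofPow_mem (a := (⟨x, hx⟩ : ↥(m ^ s))) (Ideal.mem_span_singleton_self x))) hg'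
      rw [← hgg'] at h2
      obtain ⟨v, hv, hvz⟩ := mem_initialSubmodule.mp h2 i
      obtain ⟨u', hu', huv⟩ := Ideal.mem_span_singleton_mul.mp hv
      rw [coeff_ofPow_self, eq_comm, ← sub_eq_zero, ← map_sub, cls_eq_zero_iff] at hvz
      refine ⟨u + u', add_mem hu hu', ?_⟩
      rw [mul_add, huv, ← sub_sub]
      exact hvz
  refine hy (Ideal.IsPrime.mem_of_pow_mem ‹_› (n + 1) (mem_of_forall_mem_sup_pow P fun i => ?_))
  obtain ⟨u, -, hu⟩ := key i
  rw [← add_sub_cancel (x * u) (y ^ (n + 1))]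
  exact Submodule.add_mem_sup (P.mul_mem_right _ hxP) hu

/-- A lower bound for the lengths of the `A / (P + 𝔪 ^ n)`, where `P` is a prime minimal over an
element of `A`. -/
theorem exists_relLength_pow_le_mul [IsDomain (Gr (maximalIdeal A))] {s : ℕ} {x : A}
    (hx : x ∈ maximalIdeal A ^ s) (hx' : x ∉ maximalIdeal A ^ (s + 1)) {P : Ideal A} [P.IsPrime]
    (hxP : x ∈ P) {y : A} (hy : y ∉ P) {k : ℕ} (hk : ∀ b ∈ P ^ k, y * b ∈ Ideal.span {x})
    (hfin : ∀ n, relLength (maximalIdeal A ^ (n + 1)) (maximalIdeal A ^ n) ≠ ⊤) :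
    ∃ M w : ℕ, 0 < w ∧ ∀ n,
      relLength (maximalIdeal A ^ (n + 1 + 1)) (maximalIdeal A ^ (n + 1)) ≤
        M * relLength (P ⊔ maximalIdeal A ^ (w * n + 2 * w + 1)) ⊤ := by
  set m := maximalIdeal A with hm
  have := finiteType_gr m
  have : Algebra.FiniteType (ResidueField A) (Gr m) :=
    Algebra.FiniteType.of_restrictScalars_finiteType A (ResidueField A) (Gr m)
  -- Noether normalization; φ need not respect degrees.
  obtain ⟨r, φ, hinj, hφ⟩ := exists_finite_inj_algHom_of_fg (ResidueField A) (Gr m)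
  let S := MvPolynomial (Fin r) (ResidueField A)
  let : Algebra S (Gr m) := φ.toRingHom.toAlgebra
  have : Module.Finite S (Gr m) := hφ
  have hAS : ∀ a, algebraMap A (Gr m) a = φ (algebraMap A S a) := by
    intro a
    rw [IsScalarTower.algebraMap_apply A (ResidueField A) S, AlgHom.commutes,
      ← IsScalarTower.algebraMap_apply]
  have : IsScalarTower A S (Gr m) := IsScalarTower.of_algebraMap_eq hAS
  set Q := initialIdeal m P with hQ
  have hQpow : ∀ n, Q ^ n ≤ initialIdeal m (P ^ n) := by
    intro n
    induction n with
    | zero =>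
      rw [pow_zero, pow_zero, Ideal.one_eq_top, Ideal.one_eq_top]
      intro g _
      refine mem_initialSubmodule.mpr fun i => ?_
      obtain ⟨a, ha⟩ := cls_surjective m i (coeff m i g)
      exact ⟨a, trivial, ha⟩
    | succ n ih =>
      rw [pow_succ, pow_succ]
      exact Ideal.mul_le.mpr fun a ha b hb => mul_mem_initialSubmodule_mul (ih ha) hb
  set ξ := ofPow m s ⟨x, hx⟩ with hξ
  have hξ0 : ξ ≠ 0 := fun h => hx' ((ofPow_eq_zero_iff _).mp h)
  -- The dichotomy on the contraction of Q: either no proper principal ideal of S contains it, which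
  -- is contradictory, or some (p) does, which yields the length bound.
  by_cases hS : ∀ p : S, ¬ IsUnit p → ∃ b, algebraMap S (Gr m) b ∈ Q ∧ ¬ p ∣ b
  · exfalso
    set J : ℕ → Ideal A := fun n => (Ideal.span {x ^ n}).colon (P ^ (k * n) : Ideal A) with hJ
    have hxJ : ∀ n, Ideal.span {x} * J n ≤ J (n + 1) := by
      intro n
      rw [Ideal.span_singleton_mul_le_iff]
      intro u hu
      rw [hJ, Submodule.mem_colon] at hu ⊢
      intro b hb
      rw [smul_eq_mul, mul_assoc, pow_succ', ← Ideal.span_singleton_mul_span_singleton]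
      exact Ideal.mul_mem_mul (Ideal.mem_span_singleton_self _)
        (hu b (Ideal.pow_le_pow_right (Nat.mul_le_mul_left k n.le_succ) hb))
    have hPJ : ∀ n, P ^ (k * n) * J n ≤ Ideal.span {x ^ n} := by
      intro n
      refine Ideal.mul_le.mpr fun b hb u hu => ?_
      rw [mul_comm]
      exact Submodule.mem_colon.mp hu b hb
    have hmono : ∀ {J J' : Ideal A}, J ≤ J' → initialIdeal m J ≤ initialIdeal m J' := by
      intro J J' h g hg
      exact mem_initialSubmodule.mpr fun i =>
        Submodule.map_mono (f := cls m i) (fun a ha => h ha) (mem_initialSubmodule.mp hg i)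
    obtain ⟨n, hn⟩ := exists_eq_mul_of_pow_mul_mem_span (S := S) hinj hξ0 (P := Q)
      (K := fun n => initialIdeal m (J n))
      (fun n g hg => hmono (hxJ n) (mul_mem_initialSubmodule_mul
        (mem_initialSubmodule.mpr (coeff_ofPow_mem (Ideal.mem_span_singleton_self x))) hg))
      (fun n b hb g hg => ⟨k * n, initialIdeal_span_pow_le hx hx' n (hmono (hPJ n)
        (mul_mem_initialSubmodule_mul (hQpow _ (Ideal.pow_mem_pow hb _)) hg))⟩) hS
    obtain ⟨g, hg, hg'⟩ := exists_mem_initialIdeal_colon_not_mul hx hxP hy hk n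
    obtain ⟨g', h1, h2⟩ := hn g hg
    exact hg' g' h1 h2
  · push Not at hS
    obtain ⟨p, hp, hpQ⟩ := hS
    -- The index shift makes the filtration multiplicative: F n consists of the elements of degree
    -- at most n, and F 0 is the image of A.
    obtain ⟨M, w, hw, h⟩ := exists_relLength_le_mul_relLength (F := fun n => degLT m (n + 1))
      (p := p) (P := Q)
      (fun i j h => degLT_mono (by omega)) (fun n => length_degLT_ne_top hfin _)
      degLT_one.le degLT_succ_le_mul (degLT_fg _) degLT_one.ge
      (fun i j => Submodule.mul_le.mpr fun a ha b hb => by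
        rw [add_right_comm]
        exact mul_mem_degLT ha hb)
      (fun g => by
        obtain ⟨n, hn⟩ := exists_mem_degLT g
        exact ⟨n, degLT_mono n.le_succ hn⟩)
      (by
        intro n g hg
        rcases eq_or_ne p 0 with rfl | hp0
        · exact ⟨0, zero_mem _, by rw [zero_smul, zero_smul]⟩
        · refine ⟨g, ?_, rfl⟩
          -- Degree zero comes from the residue field, so a nonzero p with image of degree zero
          -- would be a constant, hence a unit. Multiplication by p therefore raises degrees by at
          -- least one.
          have h1 : φ p ∉ degLT m 1 := by
            intro h
            rw [degLT_one] at h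
            obtain ⟨a, ha⟩ := Submodule.mem_one.mp h
            rw [hAS] at ha
            have hpa := hinj ha
            rw [IsScalarTower.algebraMap_apply A (ResidueField A) S] at hpa
            refine hp (hpa ▸ (IsUnit.mk0 _ fun h0 => hp0 ?_).map (algebraMap (ResidueField A) S))
            rw [← hpa, h0, map_zero]
          obtain ⟨f, hf, hpf, hpf'⟩ := exists_top_coeff h1
          refine mem_degLT_of_mul_mem hpf hpf' (degLT_mono (show n + 2 ≤ f + (n + 1) by omega) ?_)
          exact hg)
      hpQ
    refine ⟨M, w, hw, fun n => ?_⟩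
    rw [← relLength_degLT]
    refine (h n).trans ?_
    gcongr
    exact relLength_initialIdeal_degLT_le P _

end AssocGraded

/-! ### Orders in A and minimal primes of (x) -/

theorem exists_mem_pow_notMem_pow_succ {A : Type*} [CommRing A] [IsLocalRing A]
    [IsNoetherianRing A] {a : A} (ha : a ≠ 0) :
    ∃ i, a ∈ maximalIdeal A ^ i ∧ a ∉ maximalIdeal A ^ (i + 1) := by
  by_contra! h
  refine ha ?_
  rw [← Ideal.mem_bot, ← Ideal.iInf_pow_eq_bot_of_isLocalRing (maximalIdeal A)
    (Ideal.IsPrime.ne_top inferInstance), Submodule.mem_iInf]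
  intro n
  induction n with
  | zero => simp
  | succ n ih => exact h n ih

theorem AssocGraded.isDomain_of_isDomain_gr {A : Type*} [CommRing A] [IsLocalRing A]
    [IsNoetherianRing A] [IsDomain (Gr (maximalIdeal A))] : IsDomain A := by
  have : NoZeroDivisors A := by
    refine ⟨fun {a b} hab => ?_⟩
    by_contra! h
    obtain ⟨i, hi, hi'⟩ := exists_mem_pow_notMem_pow_succ h.1
    obtain ⟨j, hj, hj'⟩ := exists_mem_pow_notMem_pow_succ h.2
    exact hj' (mem_pow_succ_of_mul_mem hi hi' hj (by rw [hab]; exact zero_mem _))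
  exact NoZeroDivisors.to_isDomain A

/-- By prime avoidance some z lies in all the other minimal primes but not in P. Then z P lies in
the radical of I, so a power of it lies in I, and a power of z serves as y. -/
theorem Ideal.exists_mem_minimalPrimes_mul_mem {A : Type*} [CommRing A] [IsNoetherianRing A]
    {I P : Ideal A} (hP : P ∈ I.minimalPrimes) :
    ∃ y ∉ P, (∀ Q ∈ I.minimalPrimes, Q ≠ P → y ∈ Q) ∧ ∃ k, ∀ b ∈ P ^ k, y * b ∈ I := by
  classical
  have hPp : P.IsPrime := hP.1.1
  let T := (I.finite_minimalPrimes_of_isNoetherianRing A).toFinset.erase P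
  have hT : ∀ Q, Q ∈ T ↔ Q ≠ P ∧ Q ∈ I.minimalPrimes := by simp [T]
  have h1 : ¬ T.inf id ≤ P := by
    rw [Ideal.IsPrime.inf_le' hPp]
    rintro ⟨Q, hQ, hQP⟩
    rw [hT] at hQ
    exact hQ.1 (le_antisymm hQP (hP.2 hQ.2.1 hQP))
  obtain ⟨z, hz, hzP⟩ := SetLike.not_le_iff_exists.mp h1
  have hzQ : ∀ Q ∈ I.minimalPrimes, Q ≠ P → z ∈ Q := fun Q hQ hQP =>
    Finset.inf_le (f := id) ((hT Q).mpr ⟨hQP, hQ⟩) hz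
  have h2 : Ideal.span {z} * P ≤ I.radical := by
    rw [← Ideal.sInf_minimalPrimes]
    refine le_sInf fun Q hQ => ?_
    by_cases hQP : Q = P
    · exact hQP ▸ Ideal.mul_le_right
    · refine Ideal.mul_le_left.trans ?_
      rw [Ideal.span_singleton_le_iff_mem]
      exact hzQ Q hQ hQP
  obtain ⟨k, hk⟩ := Ideal.exists_pow_le_of_le_radical_of_fg h2 (IsNoetherian.noetherian _)
  refine ⟨z ^ (k + 1), fun h => hzP (hPp.mem_of_pow_mem _ h),
    fun Q hQ hQP => Ideal.pow_mem_of_mem _ (hzQ Q hQ hQP) _ k.succ_pos, k, fun b hb => ?_⟩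
  rw [mul_pow, Ideal.span_singleton_pow] at hk
  rw [pow_succ', mul_assoc]
  exact I.mul_mem_left _ (hk (Ideal.mul_mem_mul (Ideal.mem_span_singleton_self _) hb))

theorem Ideal.mem_minimalPrimes_span_singleton_of_height_eq_one {A : Type*} [CommRing A]
    [IsDomain A] {P : Ideal A} [P.IsPrime] {x : A} (hx : x ≠ 0) (hxP : x ∈ P)
    (hP : P.height = 1) : P ∈ (Ideal.span {x}).minimalPrimes := by
  obtain ⟨Q, hQ, hQP⟩ :=
    Ideal.exists_minimalPrimes_le ((Ideal.span_singleton_le_iff_mem P).mpr hxP)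
  rcases hQP.eq_or_lt with rfl | hlt
  · exact hQ
  have hQp : Q.IsPrime := hQ.1.1
  have hxQ : x ∈ Q := hQ.1.2 (Ideal.mem_span_singleton_self x)
  have h0 : ⊥ < Q := bot_lt_iff_ne_bot.mpr fun h => hx (by rwa [h, Ideal.mem_bot] at hxQ)
  have h1 := Ideal.height_add_one_le_of_lt_of_isPrime hlt
  have h2 := Ideal.height_add_one_le_of_lt_of_isPrime h0
  have h3 : (1 + 1 : ℕ∞) ≤ 1 := by
    rw [← hP]
    calc (P.height + P.height) = 1 + 1 := by rw [hP]
      _ ≤ ((⊥ : Ideal A).height + 1) + 1 := by gcongr; exact le_add_self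
      _ ≤ Q.height + 1 := by gcongr
      _ ≤ P.height := h1
  exact absurd h3 (by decide)

/-! ### Adding up lengths over several primes -/

section Sum

variable {A : Type*} [CommRing A] [IsNoetherianRing A] [IsLocalRing A]

/-- The lengths of the quotients by distinct incomparable primes `P ⊇ I` add up, with a
bounded shift. -/
theorem exists_sum_samuelLength_le {I : Ideal A} (T : Finset (Ideal A)) (y : Ideal A → A)
    (hprime : ∀ P ∈ T, P.IsPrime) (hI : ∀ P ∈ T, I ≤ P) (hy : ∀ P ∈ T, y P ∉ P)
    (hy' : ∀ P ∈ T, ∀ Q ∈ T, Q ≠ P → y P ∈ Q) :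
    ∃ c, ∀ n, ∑ P ∈ T, samuelLength P (maximalIdeal A) n ≤
      samuelLength I (maximalIdeal A) (n + c) := by
  classical
  set m := maximalIdeal A with hm
  have hq : m ^ 1 ≤ m := by simp
  have h1 : ∀ P ∈ T, ∃ c, ∀ n a, y P * a ∈ P ⊔ m ^ (n + c) → a ∈ P ⊔ m ^ n := by
    intro P hP
    have := hprime P hP
    exact exists_mem_sup_pow_of_mul_mem m P (hy P hP)
  choose! c hc using h1
  refine ⟨∑ P ∈ T, c P, fun n => ?_⟩
  set C := ∑ P ∈ T, c P with hC
  have hcC : ∀ P ∈ T, c P ≤ C := fun P hP => Finset.single_le_sum (fun _ _ => Nat.zero_le _) hP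
  -- Modulo Q only the term y Q * a Q of this sum survives, because y P ∈ Q for the other P. The
  -- Artin-Rees constant then recovers a Q modulo Q + 𝔪^n.
  let φ : (T → A) →ₗ[A] A := ∑ P : T, (LinearMap.mulLeft A (y P)).comp (LinearMap.proj P)
  have hφ : ∀ a, φ a = ∑ P : T, y P * a P := fun a => by simp [φ]
  let Y : Submodule A (T → A) := Submodule.comap φ (I ⊔ m ^ (n + C))
  have h2 : relLength Y ⊤ ≤ relLength (I ⊔ m ^ (n + C)) ⊤ :=
    relLength_le_of_map_le φ le_top fun a _ ha => ha
  let ψ : (T → A) →ₗ[A] ∀ P : T, A ⧸ ((P : Ideal A) ⊔ m ^ n) :=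
    LinearMap.pi fun P => (Submodule.mkQ ((P : Ideal A) ⊔ m ^ n)).comp (LinearMap.proj P)
  have h3 : relLength (⊥ : Submodule A (∀ P : T, A ⧸ ((P : Ideal A) ⊔ m ^ n))) ⊤ ≤
      relLength Y ⊤ := by
    refine relLength_le_of_le_map ψ ?_ fun a _ ha => ?_
    · refine fun b _ => Submodule.mem_sup_left ?_
      choose a ha using fun P => Submodule.mkQ_surjective _ (b P)
      exact ⟨a, trivial, funext ha⟩
    · rw [Submodule.mem_bot]
      funext Q
      change Submodule.mkQ _ (a Q) = 0
      rw [Submodule.mkQ_apply, Submodule.Quotient.mk_eq_zero]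
      apply hc Q Q.2
      have h4 : φ a ∈ (Q : Ideal A) ⊔ m ^ (n + c Q) :=
        sup_le_sup (hI Q Q.2) (Ideal.pow_le_pow_right (Nat.add_le_add_left (hcC Q Q.2) n)) ha
      rw [hφ, ← Finset.add_sum_erase _ _ (Finset.mem_univ Q)] at h4
      refine (Submodule.add_mem_iff_left _ (Submodule.mem_sup_left (sum_mem fun P hP => ?_))).mp h4
      refine Ideal.mul_mem_right _ _ (hy' P P.2 Q Q.2 fun h => ?_)
      exact (Finset.mem_erase.mp hP).1 (Subtype.ext h.symm)
  have h5 := h3.trans h2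
  rw [relLength_bot, Module.length_top, Module.length_pi_of_fintype, ← coe_samuelLength hq] at h5
  simp_rw [← relLength_top, ← coe_samuelLength hq] at h5
  rw [← Nat.cast_sum] at h5
  rw [← Finset.sum_coe_sort]
  exact_mod_cast h5

theorem relLength_pow_succ_add_samuelLength (n : ℕ) :
    relLength (maximalIdeal A ^ (n + 1)) (maximalIdeal A ^ n) +
      samuelLength (⊥ : Ideal A) (maximalIdeal A) n =
      samuelLength (⊥ : Ideal A) (maximalIdeal A) (n + 1) := by
  have hq : maximalIdeal A ^ 1 ≤ maximalIdeal A := by simp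
  rw [coe_samuelLength hq, coe_samuelLength hq, bot_sup_eq, bot_sup_eq]
  exact relLength_add (Ideal.pow_le_pow_right n.le_succ) le_top

end Sum

/-! ### The dimension of A/P and the multiplicity bound -/

namespace AssocGraded

variable {A : Type*} [CommRing A] [IsLocalRing A] [IsNoetherianRing A]
  [IsDomain (Gr (maximalIdeal A))]

/-- If the associated graded ring is a domain, the quotient by a prime of height one that is
minimal over an element has dimension one less. -/
theorem growth_degree_eq {s : ℕ} {x : A}
    (hx : x ∈ maximalIdeal A ^ s) (hx' : x ∉ maximalIdeal A ^ (s + 1)) {P : Ideal A} [P.IsPrime]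
    (hxP : x ∈ P) {y : A} (hy : y ∉ P) {k : ℕ} (hk : ∀ b ∈ P ^ k, y * b ∈ Ideal.span {x})
    {D D' e e' : ℕ} (h : HasGrowth (samuelLength (⊥ : Ideal A) (maximalIdeal A)) D e)
    (h' : HasGrowth (samuelLength P (maximalIdeal A)) D' e') : D = D' + 1 := by
  have := isDomain_of_isDomain_gr (A := A)
  have hq : maximalIdeal A ^ 1 ≤ maximalIdeal A := by simp
  have hP : ⊥ < P := bot_lt_iff_ne_bot.mpr fun h0 => hx' (by
    rw [h0, Ideal.mem_bot] at hxP
    rw [hxP]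
    exact zero_mem _)
  have h1 := h.succ_le_of_lt hP h'
  obtain ⟨E, rfl⟩ := Nat.exists_eq_add_of_le' (Nat.succ_le_iff.mp ((Nat.succ_le_succ
    (Nat.zero_le D')).trans h1))
  refine le_antisymm (Nat.succ_le_succ (le_of_isBigO_pow ?_)) h1
  -- The Hilbert function of G grows like n^E, and it is at most M times the Samuel function of P at
  -- a linear argument, which is O(n^D'). Hence E ≤ D'.
  obtain ⟨M, w, hw, hM⟩ := exists_relLength_pow_le_mul hx hx' hxP hy hk fun n hn => by
    have h2 := relLength_pow_succ_add_samuelLength (A := A) n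
    rw [hn, top_add] at h2
    exact ENat.top_ne_natCast _ h2
  have h3 := h.isBigO_of_diff.comp_tendsto (tendsto_add_atTop_nat 1)
  have h4 := (h'.isBigO_comp hw (2 * w + 1)).const_mul_left (M : ℝ)
  refine (Asymptotics.IsBigO.of_norm_le fun n => ?_).trans
    (h3.trans ((Asymptotics.IsBigO.of_norm_le fun n => ?_).trans h4))
  · simp only [Function.comp_apply, norm_pow, Real.norm_natCast]
    push_cast
    gcongr
    linarith
  · simp only [Function.comp_apply]
    have h5 := relLength_pow_succ_add_samuelLength (A := A) (n + 1)
    have h6 := hM n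
    rw [← coe_samuelLength hq] at h6
    have h7 : (samuelLength (⊥ : Ideal A) (maximalIdeal A) (n + 1 + 1) : ℕ∞) ≤
        ((M * samuelLength P (maximalIdeal A) (w * n + 2 * w + 1) +
          samuelLength (⊥ : Ideal A) (maximalIdeal A) (n + 1) : ℕ) : ℕ∞) := by
      rw [← h5]
      push_cast
      gcongr
    have h8 : (samuelLength (⊥ : Ideal A) (maximalIdeal A) (n + 1 + 1) : ℝ) ≤
        M * samuelLength P (maximalIdeal A) (w * n + 2 * w + 1) +
          samuelLength (⊥ : Ideal A) (maximalIdeal A) (n + 1) := by exact_mod_cast h7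
    have h9 : (samuelLength (⊥ : Ideal A) (maximalIdeal A) (n + 1) : ℝ) ≤
        samuelLength (⊥ : Ideal A) (maximalIdeal A) (n + 1 + 1) := by
      exact_mod_cast samuelLength_anti (c := 1) (by simp)
        (sup_le_sup_left (Ideal.pow_le_pow_right (n + 1).le_succ) _)
    rw [Real.norm_of_nonneg (by linarith), ← add_assoc]
    linarith

theorem sum_multiplicity_le [IsDomain A] {s : ℕ} {x : A}
    (hx : x ∈ maximalIdeal A ^ s) (hx' : x ∉ maximalIdeal A ^ (s + 1)) (T : Finset (Ideal A))
    (y : Ideal A → A) (hprime : ∀ P ∈ T, P.IsPrime) (hxP : ∀ P ∈ T, x ∈ P)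
    (hy : ∀ P ∈ T, y P ∉ P) (hy' : ∀ P ∈ T, ∀ Q ∈ T, Q ≠ P → y P ∈ Q) {E e : ℕ}
    (h : HasGrowth (samuelLength (⊥ : Ideal A) (maximalIdeal A)) (E + 1) e)
    (e' : Ideal A → ℕ) (h' : ∀ P ∈ T, HasGrowth (samuelLength P (maximalIdeal A)) E (e' P)) :
    ∑ P ∈ T, e' P ≤ s * e := by
  set m := maximalIdeal A with hm
  obtain ⟨c, hc⟩ := exists_sum_samuelLength_le (I := Ideal.span {x}) T y hprime
    (fun P hP => (Ideal.span_singleton_le_iff_mem P).mpr (hxP P hP)) hy hy'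
  -- Additivity of orders makes the shift exactly s, in place of an unspecified Artin-Rees constant.
  -- This is the source of the factor s in the bound.
  have h1 : ∀ n, samuelLength (Ideal.span {x}) m (n + s) + samuelLength ⊥ m n ≤
      samuelLength ⊥ m (n + s) := by
    intro n
    have := samuelLength_add_le (p := (⊥ : Ideal A)) (x := x) (c := s) (fun n a ha => by
      rw [bot_sup_eq] at ha ⊢
      exact mem_pow_of_mul_mem hx hx' (by rwa [add_comm] at ha)) n
    rwa [bot_sup_eq] at this
  have h2 : ∀ n, ∑ P ∈ T, (samuelLength P m n : ℝ) ≤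
      ((samuelLength ⊥ m (n + (c + s)) : ℝ) - samuelLength ⊥ m n) -
        ((samuelLength ⊥ m (n + c) : ℝ) - samuelLength ⊥ m n) := by
    intro n
    have h3 := (Nat.add_le_add_right (hc n) _).trans ((Nat.add_le_add_right
      (samuelLength_anti (c := 1) (by simp) (sup_le_sup_left
        (Ideal.pow_le_pow_right (Nat.le_add_right (n + c) s)) _)) _).trans (h1 (n + c)))
    have h4 : ∑ P ∈ T, (samuelLength P m n : ℝ) + samuelLength ⊥ m (n + c) ≤
      samuelLength ⊥ m (n + (c + s)) := by
      rw [← add_assoc]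
      exact_mod_cast h3
    linarith
  have hl : Tendsto (fun n : ℕ => ∑ P ∈ T, (samuelLength P m n : ℝ) / (n : ℝ) ^ E) atTop
      (nhds (∑ P ∈ T, (e' P : ℝ) / E.factorial)) :=
    tendsto_finsetSum T fun P hP => (h' P hP).tendsto
  -- The shifts c + s and c contribute (c + s) e / E! and c e / E!, so the auxiliary c cancels and s
  -- e / E! remains.
  have hr := (h.tendsto_diff_shift (c + s)).sub (h.tendsto_diff_shift c)
  have h5 := le_of_tendsto_of_tendsto hl hr (by
    filter_upwards [eventually_gt_atTop 0] with n hn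
    rw [← Finset.sum_div, ← sub_div, ← sub_mul, pow_succ, mul_div_mul_right _ _ (by positivity)]
    gcongr
    exact h2 n)
  have h6 : (E.factorial : ℝ) ≠ 0 := by positivity
  have h7 : (0 : ℝ) < E.factorial := by positivity
  rw [← Finset.sum_div, Nat.factorial_succ, div_le_iff₀ h7] at h5
  have h8 : (∑ P ∈ T, (e' P : ℝ)) ≤ s * e := by
    refine h5.trans_eq ?_
    push_cast
    field_simp
    ring
  exact_mod_cast h8

end AssocGraded

/-! ### The counting theorem -/

theorem hilbertSamuelFunction_eq_samuelLength {A : Type*} [CommRing A] [IsLocalRing A] (n : ℕ) :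
    hilbertSamuelFunction A n = samuelLength ⊥ (maximalIdeal A) n := by
  rw [samuelLength, bot_sup_eq, hilbertSamuelFunction]

theorem lemma2p1 {A : Type*} [CommRing A] [IsLocalRing A] [IsNoetherianRing A]
    (hG : IsDomain (AssociatedGradedRing (maximalIdeal A)))
    (s : ℕ) (x : A) (hx : x ∈ maximalIdeal A ^ s) (hx' : x ∉ maximalIdeal A ^ (s + 1)) :
    Tendsto (normalizedHilbertSamuel A) atTop (nhds (hilbertSamuelMultiplicity A)) ∧
    (associatedPrimesOfHeight A (A ⧸ Ideal.span {x}) 1).Finite ∧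
    ((associatedPrimesOfHeight A (A ⧸ Ideal.span {x}) 1).ncard : ℝ) ≤
      s * hilbertSamuelMultiplicity A := by
  have : IsDomain (AssocGraded.Gr (maximalIdeal A)) := hG
  have := AssocGraded.isDomain_of_isDomain_gr (A := A)
  obtain ⟨D, e, h⟩ := exists_hasGrowth_samuelLength_maximalIdeal (bot_ne_top : (⊥ : Ideal A) ≠ ⊤)
  have hD := natKrullDim_eq_of_hasGrowth h
  have h1 : Tendsto (normalizedHilbertSamuel A) atTop (nhds (e : ℝ)) := by
    have h2 := h.tendsto.const_mul (D.factorial : ℝ)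
    rw [mul_div_cancel₀ _ (by positivity)] at h2
    refine h2.congr fun n => ?_
    rw [normalizedHilbertSamuel, hD, hilbertSamuelFunction_eq_samuelLength, mul_div_assoc]
  have he : hilbertSamuelMultiplicity A = e := h1.limUnder_eq
  have hfin : (associatedPrimesOfHeight A (A ⧸ Ideal.span {x}) 1).Finite :=
    (associatedPrimes.finite A (A ⧸ Ideal.span {x})).subset fun P hP => hP.1
  refine ⟨he ▸ h1, hfin, ?_⟩
  rw [he, Set.ncard_eq_toFinset_card _ hfin]
  set T := hfin.toFinset with hT
  -- A member of T is what shows that the degree D is positive; for empty T only s e₀ ≥ 0 is needed.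
  rcases T.eq_empty_or_nonempty with h0 | ⟨P₀, hP₀⟩
  · rw [h0, Finset.card_empty, Nat.cast_zero]
    positivity
  have hprime : ∀ P ∈ T, P.IsPrime := fun P hP => (hfin.mem_toFinset.mp hP).1.isPrime
  have hxP : ∀ P ∈ T, x ∈ P := by
    intro P hP
    have h2 : Module.annihilator A (A ⧸ Ideal.span {x}) ≤ P := by
      rw [← Submodule.annihilator_top]
      exact (hfin.mem_toFinset.mp hP).1.annihilator_le
    rw [Ideal.annihilator_quotient] at h2
    exact h2 (Ideal.mem_span_singleton_self x)
  have hmin : ∀ P ∈ T, P ∈ (Ideal.span {x}).minimalPrimes := by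
    intro P hP
    have := hprime P hP
    exact Ideal.mem_minimalPrimes_span_singleton_of_height_eq_one
      (fun h => hx' (h ▸ zero_mem _)) (hxP P hP) (hfin.mem_toFinset.mp hP).2
  choose! y hy hy' k hk using fun (P : Ideal A) (hP : P ∈ T) =>
    Ideal.exists_mem_minimalPrimes_mul_mem (hmin P hP)
  choose! D' e' h' using fun (P : Ideal A) (hP : P ∈ T) =>
    exists_hasGrowth_samuelLength_maximalIdeal (hprime P hP).ne_top
  have hdeg : ∀ P ∈ T, D = D' P + 1 := by
    intro P hP
    have := hprime P hP
    exact AssocGraded.growth_degree_eq hx hx' (hxP P hP) (hy P hP) (hk P hP) h (h' P hP)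
  obtain ⟨E, rfl⟩ : ∃ E, D = E + 1 := ⟨_, hdeg P₀ hP₀⟩
  have hsum := AssocGraded.sum_multiplicity_le hx hx' T y hprime hxP hy
    (fun P hP Q hQ hQP => hy' P hP Q (hmin Q hQ) hQP) h e' fun P hP => by
      have h2 := h' P hP
      rwa [← Nat.succ_injective (hdeg P hP)] at h2
  -- Each leading coefficient e' P is a positive integer, so it contributes at least 1.
  have hcard : T.card ≤ ∑ P ∈ T, e' P := by
    rw [Finset.card_eq_sum_ones]
    exact Finset.sum_le_sum fun P hP => (h' P hP).pos
  exact_mod_cast hcard.trans hsum
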